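/- **Setting.** A Markov chain with rewards $(S,\partial S,p,r)$ consists of a (measurable) state space $S$, terminal states $\partial S\subseteq S$, a transition kernel $p$ and a reward function $r:S\to\mathbb R$, where each $s\in\partial S$ is absorbing and $r(s)=0$ there. A state $s$ is *free* if $r(s)\ge 0$ and $p(s)(\partial S)=0$. Let $\tau$ be the hitting time of $\partial S$. For $\alpha\in\mathbb R$, the *local MDP* with alternative $\alpha$ has two actions in each state $s$: "go", which earns $r(s)$ and moves to $s'\sim p(s)$, and "stop", which earns $\alpha$ and ends the process. The process also ends when the chain reaches $\partial S$. Let $V_{\mathrm{loc}}^*(s;\alpha)$ be the supremum, over policies mapping states to actions, of the expected total reward from $s$. The *Gittins index* $G(s)$ is the unique $g\in\mathbb R$ for which both actions are optimal at the initial state $s$ with alternative $g$, i.e. $g=V_{\mathrm{loc}}^*(s;g)=r(s)+\mathbb E_{s'\sim p(s)}V_{\mathrm{loc}}^*(s';g)$, or $\infty$ if there is no such unique number. For $s\notin\partial S$ the *surrogate value* is the random variable $\Gamma(s)=\min_{0\le u<\tau}G(s(u))$, where $s(0)=s,s(1),\dots$ is a trajectory of the chain. Let $n\ge 1$, and let $(S_i,\partial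 S_i,p_i,r_i)$, $i=1,\dots,n$, be Markov chains with rewards such that, for every $i$: from every initial state the chain reaches $\partial S_i$ in finite time almost surely and the sum of the absolute values of its rewards until then has finite expectation; and no state is free. Undiscounted *Markov chain selection (MCS)* is the decision process on $S_1\times\dots\times S_n$ in which playing action $i$ in state $(s_1,\dots,s_n)$ earns $r_i(s_i)$ and replaces $s_i$ by a sample of $p_i(s_i)$, and which ends as soon as some $s_i\in\partial S_i$. A policy is a (measurable) map $\pi:S_1\times\dots\times S_n\to\{1,\dots,n\}$, its value is the expected total reward until the end, and $V^*_{\mathrm{MCS}}$ is the supremum of the values of all policies. For $f:S_1\times\dots\times S_n\to\mathbb R$ write $$\mathcal B_i f(s_1,\dots,s_n)=r_i(s_i)+\mathbb E_{s_i'\sim p_i(s_i)} f(s_1,\dots,s_i',\dots,s_n).$$ **Theorem.** Under every policy and from every initial state, MCS ends in finite time almost surely with absolutely integrable total reward, and $V^*_{\mathrm{MCS}}$ is finite. The surrogate values of non-terminal states are almost surely finite, and, with $\Gamma_1(s_1),\dots,\Gamma_n(s_n)$ independent, $$V_{\mathrm{MCS}}^*(s_1,\dots,s_n)=\begin{cases}\mathbb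 E\big[\max_{1\le i\le n}\Gamma_i(s_i)\big] & \text{if } s_i\notin\partial S_i\text{ for all }i,\\ 0&\text{otherwise,}\end{cases}$$ where the maximum is integrable. Moreover, whenever $s_i\notin\partial S_i$ for all $i$, the functions $s_i'\mapsto V^*_{\mathrm{MCS}}(s_1,\dots,s_i',\dots,s_n)$ are $p_i(s_i)$-integrable, the Bellman equation $V^*_{\mathrm{MCS}}(s_1,\dots,s_n)=\max_i\mathcal B_iV^*_{\mathrm{MCS}}(s_1,\dots,s_n)$ holds, and its maximizers are exactly the chains of maximal Gittins index: $$\operatorname*{arg\,max}_{i}\ \mathcal B_iV^*_{\mathrm{MCS}}(s_1,\dots,s_n)=\operatorname*{arg\,max}_{i}\ G_i(s_i).$$ Finally, there is a Gittins policy, i.e. a policy that in every non-terminal state plays a chain of maximal Gittins index, and every Gittins policy (whatever its tie-breaking) has value $V^*_{\mathrm{MCS}}$ from every initial state. -/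

import Mathlib

open MeasureTheory ProbabilityTheory

noncomputable section

namespace MCS

/-! ### Trajectories of a Markov kernel and sums until termination -/

section Trajectory

variable {S : Type*} [MeasurableSpace S]

/-- The law on `ℕ → S` of the time-homogeneous Markov chain `s(0), s(1), …` with transition
kernel `κ` and initial state `s(0) = s`. -/
def pathLaw (κ : Kernel S S) [IsMarkovKernel κ] (s : S) : Measure (ℕ → S) :=
  Kernel.traj (X := fun _ => S)
    (fun n => κ.comap (fun h : (i : Finset.Iic n) → S => h ⟨n, Finset.mem_Iic.2 le_rfl⟩)
      (measurable_pi_apply _)) 0 (fun _ => s)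

/-- The times `t < τ`, where `τ` is the hitting time of `D` by the trajectory `x`. -/
def timesBefore (D : Set S) (x : ℕ → S) : Set ℕ := {t | ∀ u ≤ t, x u ∉ D}

/-- The sum of `f (x t)` over the times `t < τ`, with `τ` the hitting time of `D`. -/
def totalBefore (D : Set S) (f : S → ℝ) (x : ℕ → S) : ℝ :=
  ∑' t, (timesBefore D x).indicator (fun t => f (x t)) t

/-- From `s`, the chain with kernel `κ` almost surely hits `D` in finite time, and the sum of the
absolute values of `f` until then has finite expectation. -/
def TerminatesIntegrably (κ : Kernel S S) [IsMarkovKernel κ] (D : Set S) (f : S → ℝ) (s : S) :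
    Prop :=
  (∀ᵐ x ∂(pathLaw κ s), ∃ t, x t ∈ D) ∧
    ∫⁻ x, ∑' t, (timesBefore D x).indicator (fun t => ‖f (x t)‖ₑ) t ∂(pathLaw κ s) < ⊤

end Trajectory

/-! ### Undiscounted Markov decision processes with terminal states -/

/-- An undiscounted Markov decision process with state space `S`, action space `A` and a set of
terminal states, at which the process ends. -/
structure MDP (S A : Type*) [MeasurableSpace S] [MeasurableSpace A] where
  terminal : Set S
  measurableSet_terminal : MeasurableSet terminal
  kernel : Kernel (S × A) S
  isMarkov : IsMarkovKernel kernel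
  reward : S → A → ℝ
  measurable_reward : Measurable (Function.uncurry reward)

attribute [instance] MDP.isMarkov

/-- Policies: measurable maps from states to actions. -/
abbrev Policy (S A : Type*) [MeasurableSpace S] [MeasurableSpace A] : Type _ :=
  {π : S → A // Measurable π}

namespace MDP

variable {S A : Type*} [MeasurableSpace S] [MeasurableSpace A] (M : MDP S A)

/-- The state transition kernel obtained by following the policy `π`. -/
def policyKernel (π : Policy S A) : Kernel S S :=
  M.kernel.comap (fun s => (s, π.1 s)) (measurable_id.prodMk π.2)

instance isMarkov_policyKernel (π : Policy S A) : IsMarkovKernel (M.policyKernel π) := by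
  unfold policyKernel; infer_instance

/-- The reward collected in each state when following the policy `π`. -/
def policyReward (π : Policy S A) (s : S) : ℝ := M.reward s (π.1 s)

/-- The value of a policy: the expected total reward collected before termination. -/
def value (π : Policy S A) (s : S) : ℝ :=
  ∫ x, totalBefore M.terminal (M.policyReward π) x ∂(pathLaw (M.policyKernel π) s)

/-- The optimal value function: the supremum of the values of all policies. -/
def optimalValue (s : S) : ℝ := ⨆ π : Policy S A, M.value π s

end MDP

/-! ### Markov chains with rewards -/

/-- A Markov chain with rewards; terminal states are absorbing with zero reward. -/
structure RewardChain (S : Type*) [MeasurableSpace S] where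
  terminal : Set S
  measurableSet_terminal : MeasurableSet terminal
  kernel : Kernel S S
  isMarkov : IsMarkovKernel kernel
  reward : S → ℝ
  measurable_reward : Measurable reward
  absorbing : ∀ s ∈ terminal, kernel s = Measure.dirac s
  reward_terminal : ∀ s ∈ terminal, reward s = 0

attribute [instance] RewardChain.isMarkov

/-- The two actions of the local MDP. -/
inductive LocalAction
  | go
  | quit

instance : MeasurableSpace LocalAction := ⊤

instance : DiscreteMeasurableSpace LocalAction := ⟨fun _ => trivial⟩

instance : Finite LocalAction :=
  Finite.of_surjective (fun b : Bool => bif b then LocalAction.go else LocalAction.quit) (by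
    rintro (_ | _)
    · exact ⟨true, rfl⟩
    · exact ⟨false, rfl⟩)

namespace RewardChain

variable {S : Type*} [MeasurableSpace S] (C : RewardChain S)

/-- A state is free if its reward is non-negative and it has zero probability of transitioning
directly into a terminal state. -/
def IsFree (s : S) : Prop := 0 ≤ C.reward s ∧ C.kernel s C.terminal = 0

/-- Transitions of the local MDP on `S ∪ {✓}`, where `✓` is `Sum.inr ()`: playing `go` in a chain
state advances the chain, and everything else leads to `✓`. -/
def localKernel : Kernel ((S ⊕ Unit) × LocalAction) (S ⊕ Unit) where
  toFun z := match z with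
    | (Sum.inl s, LocalAction.go) => (C.kernel s).map Sum.inl
    | _ => Measure.dirac (Sum.inr ())
  measurable' := by
    refine measurable_from_prod_countable_left fun a => ?_
    cases a with
    | go =>
      refine measurable_fun_sum ?_ measurable_const
      exact (Measure.measurable_map _ measurable_inl).comp C.kernel.measurable
    | quit =>
      exact measurable_fun_sum measurable_const measurable_const

instance isMarkov_localKernel : IsMarkovKernel C.localKernel := by
  refine ⟨?_⟩
  rintro ⟨s | u, a | a⟩
  · exact Measure.isProbabilityMeasure_map measurable_inl.aemeasurable
  · exact Measure.dirac.isProbabilityMeasure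
  · exact Measure.dirac.isProbabilityMeasure
  · exact Measure.dirac.isProbabilityMeasure

/-- Rewards of the local MDP with alternative `α`. -/
def localReward (α : ℝ) : S ⊕ Unit → LocalAction → ℝ
  | Sum.inl s, LocalAction.go => C.reward s
  | Sum.inl _, LocalAction.quit => α
  | Sum.inr _, _ => 0

/-- The local MDP with alternative `α`. It ends once the alternative has been taken or the chain
has reached a terminal state. -/
def localMDP (α : ℝ) : MDP (S ⊕ Unit) LocalAction where
  terminal := Sum.inl '' C.terminal ∪ Set.range Sum.inr
  measurableSet_terminal := C.measurableSet_terminal.inl_image.union measurableSet_range_inr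
  kernel := C.localKernel
  isMarkov := C.isMarkov_localKernel
  reward := C.localReward α
  measurable_reward := by
    refine measurable_from_prod_countable_left fun a => ?_
    cases a with
    | go => exact measurable_fun_sum C.measurable_reward measurable_const
    | quit => exact measurable_fun_sum measurable_const measurable_const

/-- The optimal value `V_loc^*(s; α)` of the local MDP. -/
def localValue (s : S) (α : ℝ) : ℝ := (C.localMDP α).optimalValue (Sum.inl s)

/-- `quit` is an optimal action in the initial state `s` of the local MDP with alternative `α`. -/
def QuitOptimal (s : S) (α : ℝ) : Prop := α = C.localValue s α

/-- `go` is an optimal action in the initial state `s` of the local MDP with alternative `α`. -/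
def GoOptimal (s : S) (α : ℝ) : Prop :=
  C.reward s + ∫ s', C.localValue s' α ∂(C.kernel s) = C.localValue s α

open Classical in
/-- The Gittins index: the unique alternative for which both actions of the local MDP are optimal,
or `∞` if there is no such number. -/
def gittins (s : S) : EReal :=
  if h : ∃! g : ℝ, C.GoOptimal s g ∧ C.QuitOptimal s g then ((h.exists.choose : ℝ) : EReal) else ⊤

/-- The surrogate value as a function of the trajectory: the minimum of the Gittins index over the
states visited before reaching a terminal state. -/
def surrogate (x : ℕ → S) : EReal := ⨅ t ∈ timesBefore C.terminal x, C.gittins (x t)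

end RewardChain

/-! ### Markov chain selection -/

section Selection

variable {n : ℕ} {S : Fin n → Type*} [∀ i, MeasurableSpace (S i)] (C : ∀ i, RewardChain (S i))

/-- The states in which some chain is terminal. -/
def selectionTerminal : Set (∀ i, S i) := {s | ∃ i, s i ∈ (C i).terminal}

/-- Action `a` replaces `s a` by a sample from the transition kernel of chain `a`, and leaves the
other components unchanged. -/
def selectionKernel : Kernel ((∀ i, S i) × Fin n) (∀ i, S i) where
  toFun z := ((C z.2).kernel (z.1 z.2)).map (Function.update z.1 z.2)
  measurable' := by
    refine measurable_from_prod_countable_left fun a => ?_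
    have hm : Measurable (fun p : (∀ i, S i) × S a => Function.update p.1 a p.2) :=
      measurable_update'
    have key : ∀ s : ∀ i, S i, ((C a).kernel (s a)).map (Function.update s a) =
        ((Kernel.id ×ₖ (C a).kernel.comap (fun s : ∀ i, S i => s a)
          (measurable_pi_apply a)).map
            (fun p : (∀ i, S i) × S a => Function.update p.1 a p.2)) s := by
      intro s
      rw [Kernel.map_apply _ hm, Kernel.prod_apply, Kernel.id_apply, Kernel.comap_apply,
        Measure.dirac_prod, Measure.map_map hm measurable_prodMk_left]
      rfl
    simp only [key]
    exact Kernel.measurable _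

instance isMarkov_selectionKernel : IsMarkovKernel (selectionKernel C) :=
  ⟨fun _ => Measure.isProbabilityMeasure_map (measurable_update _).aemeasurable⟩

/-- The undiscounted Markov chain selection problem with chains `C i`. -/
def selectionMDP : MDP (∀ i, S i) (Fin n) where
  terminal := selectionTerminal C
  measurableSet_terminal := by
    have h : selectionTerminal C = ⋃ i, (fun s : ∀ i, S i => s i) ⁻¹' (C i).terminal := by
      ext s; simp [selectionTerminal]
    rw [h]
    exact MeasurableSet.iUnion fun i => measurable_pi_apply i (C i).measurableSet_terminal
  kernel := selectionKernel C
  isMarkov := isMarkov_selectionKernel C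
  reward := fun s a => (C a).reward (s a)
  measurable_reward :=
    measurable_from_prod_countable_left fun a =>
      (C a).measurable_reward.comp (measurable_pi_apply a)

/-- The Bellman operator of action `i`, acting on functions of the `i`-th coordinate. -/
def bellman (i : Fin n) (f : (∀ i, S i) → ℝ) (s : ∀ i, S i) : ℝ :=
  (C i).reward (s i) + ∫ s', f (Function.update s i s') ∂((C i).kernel (s i))

/-- The joint law of independent trajectories of all the chains, the `i`-th one started in `s i`. -/
def jointLaw (s : ∀ i, S i) : Measure (∀ i, ℕ → S i) :=
  Measure.pi fun i => pathLaw (C i).kernel (s i)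

/-- The maximum of the surrogate values of the chains along the given trajectories. -/
def maxSurrogate (x : ∀ i, ℕ → S i) : EReal := ⨆ i, (C i).surrogate (x i)

/-- A Gittins policy: in every non-terminal state it plays a chain of maximal Gittins index. Ties
may be broken in any way. -/
def IsGittinsPolicy (π : Policy (∀ i, S i) (Fin n)) : Prop :=
  ∀ s, s ∉ selectionTerminal C →
    ∀ j, (C j).gittins (s j) ≤ (C (π.1 s)).gittins (s (π.1 s))

end Selection

end MCS

end

/-! Fix a chain i and let m be the maximum of the surrogate values of the other chains. By
independence, the expected maximum of all surrogate values is the average over m of E max(m, Γ_i),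
and E max(m, Γ_i) is the optimal value of the local MDP of chain i with alternative m
(`Terminating.integral_max_surr`). Action i moves chain i only and leaves the law of m alone. Hence
the loss of action i in the Bellman equation is the average over m of the loss of `go` against m
(`surrogateValue_sub_bellman`). This loss is nonnegative, and it vanishes exactly when m ≤ G_i. As
the essential supremum of Γ_j is G_j, m ≤ G_i holds almost surely iff chain i has maximal index. So
the expected maximum solves the Bellman equation with the right maximizers
(`bellman_surrogateValue_eq_iff`), and a verification argument identifies it with the optimal value.

Three points need work. The first is the identity V(α) = E max(α, Γ). Stopping is optimal exactly on
Z_α = {G ≤ α}; a path that meets Z_α has Γ ≤ α, and one that misses it has Γ ≥ α. Therefore the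
increments of both sides from α to β lie between β - α times the probabilities of hitting Z_α and
Z_β. By `eq_of_abs_sub_le_mul_sub` the two sides differ by a constant, and they agree for large α.

The second is that the index is a finite number. Without free states, a large alternative outweighs
the immediate reward of `go`, and the limiting gain over stopping is subharmonic, hence zero. So
`go` eventually loses, and convexity together with the Lipschitz bound leaves one crossing point.

The third is the comparison principle without discounting: subharmonic functions must be shown to
vanish although they are unbounded. `SmallTails` is the form of uniform integrability used for this;
it passes from the single chains to selection under any policy by summation. -/

noncomputable section

namespace MCS

/-! ### The Markov property at time one -/

section MarkovProperty

open Kernel Preorder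

variable {S : Type*} [MeasurableSpace S]

/-- The trajectory that starts in `s` and continues with `x`. -/
def consPath (s : S) (x : ℕ → S) : ℕ → S
  | 0 => s
  | n + 1 => x n

omit [MeasurableSpace S] in
@[simp] lemma consPath_zero (s : S) (x : ℕ → S) : consPath s x 0 = s := rfl

omit [MeasurableSpace S] in
@[simp] lemma consPath_succ (s : S) (x : ℕ → S) (n : ℕ) : consPath s x (n + 1) = x n := rfl

lemma measurable_uncurry_consPath :
    Measurable (fun p : S × (ℕ → S) => consPath p.1 p.2) := by
  refine measurable_pi_lambda _ fun n => ?_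
  cases n with
  | zero => exact measurable_fst
  | succ n => exact (measurable_pi_apply n).comp measurable_snd

lemma measurable_consPath (s : S) : Measurable (consPath s) :=
  measurable_uncurry_consPath.comp measurable_prodMk_left

variable (κ : Kernel S S) [IsMarkovKernel κ]

/-- The kernels that produce the next state of a trajectory from its past. -/
abbrev stepKernel (n : ℕ) : Kernel ((i : Finset.Iic n) → S) S :=
  κ.comap (fun h : (i : Finset.Iic n) → S => h ⟨n, Finset.mem_Iic.2 le_rfl⟩)
    (measurable_pi_apply _)

/-- `pathLaw` as a kernel. -/
def pathKernel : Kernel S (ℕ → S) :=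
  (traj (X := fun _ => S) (stepKernel κ) 0).comap (fun s _ => s)
    (measurable_pi_lambda _ fun _ => measurable_id)

lemma pathKernel_apply (s : S) : pathKernel κ s = pathLaw κ s := rfl

instance : IsMarkovKernel (pathKernel κ) := by unfold pathKernel; infer_instance

instance (s : S) : IsProbabilityMeasure (pathLaw κ s) := by
  rw [← pathKernel_apply]; infer_instance

/-- Time homogeneity: prefixing a state shifts the clock by one, and the step kernels do not depend
on the clock. The induction integrates out the last coordinate first. -/
lemma lmarginalPartialTraj_consPath {G : (ℕ → S) → ENNReal} (hG : Measurable G) (b : ℕ) (s : S)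
    (x : ℕ → S) :
    lmarginalPartialTraj (X := fun _ => S) (stepKernel κ) 1 (b + 1) G (consPath s x) =
      lmarginalPartialTraj (X := fun _ => S) (stepKernel κ) 0 b (fun y => G (consPath s y)) x := by
  induction b generalizing G x with
  | zero =>
    have hGs : Measurable fun y => G (consPath s y) := hG.comp (measurable_consPath s)
    rw [lmarginalPartialTraj_le _ le_rfl hG, lmarginalPartialTraj_le _ le_rfl hGs]
  | succ b ih =>
    have hGs : Measurable fun y => G (consPath s y) := hG.comp (measurable_consPath s)
    rw [← lmarginalPartialTraj_self (b := b + 1) (by omega) (by omega) hG,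
      ← lmarginalPartialTraj_self (b := b) (by omega) (by omega) hGs,
      ih (measurable_lmarginalPartialTraj _ _ hG)]
    congr 1
    funext y
    rw [lmarginalPartialTraj_succ _ hG, lmarginalPartialTraj_succ _ hGs]
    have hu : ∀ z, Function.update (consPath s y) (b + 1 + 1) z =
        consPath s (Function.update y (b + 1) z) := by
      intro z; funext k
      cases k with
      | zero => rfl
      | succ k => simp [Function.update_apply]
    simp only [hu]
    rfl

lemma lintegral_traj_eq_lmarginalPartialTraj {G : (ℕ → S) → ENNReal} (hG : Measurable G) {b : ℕ}
    (hb : DependsOn G (Finset.Iic b)) (x : ℕ → S) :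
    ∫⁻ y, G y ∂(traj (X := fun _ => S) (stepKernel κ) 0 (frestrictLe 0 x)) =
      lmarginalPartialTraj (X := fun _ => S) (stepKernel κ) 0 b G x := by
  have hGu : Measurable fun z : (i : Finset.Iic b) → S =>
      G (Function.updateFinset x (Finset.Iic b) z) := hG.comp measurable_updateFinset
  rw [lmarginalPartialTraj, ← traj_map_frestrictLe_apply, lintegral_map hGu (by fun_prop)]
  refine lintegral_congr fun y => hb fun i hi => ?_
  simp only [Finset.coe_Iic, Set.mem_Iic] at hi
  simp [Function.updateFinset, hi]

/-- The law of the trajectory after its first step. -/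
def consKernel : Kernel S (ℕ → S) :=
  (Kernel.id ×ₖ (pathKernel κ ∘ₖ κ)).map (fun p => consPath p.1 p.2)

instance : IsMarkovKernel (consKernel κ) :=
  IsMarkovKernel.map _ measurable_uncurry_consPath

lemma lintegral_consKernel (s : S) {g : (ℕ → S) → ENNReal} (hg : Measurable g) :
    ∫⁻ x, g x ∂(consKernel κ s) =
      ∫⁻ s', ∫⁻ x, g (consPath s x) ∂(pathLaw κ s') ∂(κ s) := by
  have h1 : Measurable fun p : S × (ℕ → S) => g (consPath p.1 p.2) :=
    hg.comp measurable_uncurry_consPath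
  have h2 : Measurable fun x : ℕ → S => g (consPath s x) := hg.comp (measurable_consPath s)
  rw [consKernel, Kernel.map_apply _ measurable_uncurry_consPath, Kernel.prod_apply,
    Kernel.id_apply, Measure.dirac_prod, lintegral_map hg measurable_uncurry_consPath,
    lintegral_map h1 measurable_prodMk_left, Kernel.lintegral_comp _ _ _ h2]
  rfl

/-- Uniqueness in the Ionescu-Tulcea theorem. `eq_traj'` asks for the finite marginals only at times
`b ≥ 1`, so the first step can be split off and the remainder shifted back by
`lmarginalPartialTraj_consPath`. -/
lemma consKernel_eq_traj :
    (consKernel κ).comap (fun h : (i : Finset.Iic 0) → S => h ⟨0, Finset.mem_Iic.2 le_rfl⟩)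
      (measurable_pi_apply _) = traj (X := fun _ => S) (stepKernel κ) 0 := by
  refine eq_traj' (X := fun _ => S) (stepKernel κ) 1 _ fun b hb => ?_
  obtain ⟨b, rfl⟩ : ∃ c, b = c + 1 := ⟨b - 1, by omega⟩
  ext1 h
  refine Measure.ext_of_lintegral _ fun f hf => ?_
  set s := h ⟨0, Finset.mem_Iic.2 le_rfl⟩ with hs
  have hG : Measurable fun x : ℕ → S => f (frestrictLe (π := fun _ => S) (b + 1) x) :=
    hf.comp (measurable_frestrictLe _)
  have hh : h = frestrictLe (π := fun _ => S) 0 (fun _ => s) := by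
    funext i
    obtain ⟨i, hi⟩ := i
    obtain rfl : i = 0 := by simpa using hi
    rfl
  rw [Kernel.map_apply _ (by fun_prop), lintegral_map hf (by fun_prop), Kernel.comap_apply, ← hs,
    lintegral_consKernel _ _ hG, ← traj_map_frestrictLe_apply, lintegral_map hf (by fun_prop),
    hh, lintegral_traj_eq_lmarginalPartialTraj κ hG (b := b + 1) ?_,
    ← lmarginalPartialTraj_self (b := 1) (by omega) (by omega) hG,
    lmarginalPartialTraj_succ _ (measurable_lmarginalPartialTraj _ _ hG)]
  · refine lintegral_congr fun s' => ?_
    have hc : Function.update (fun _ : ℕ => s) (0 + 1) s' =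
        consPath s (Function.update (fun _ : ℕ => s) 0 s') := by
      funext k
      cases k with
      | zero => rfl
      | succ k => simp [Function.update_apply]
    have hGs : Measurable fun x : ℕ → S =>
        f (frestrictLe (π := fun _ => S) (b + 1) (consPath s x)) :=
      hG.comp (measurable_consPath s)
    rw [hc, lmarginalPartialTraj_consPath κ hG,
      ← lintegral_traj_eq_lmarginalPartialTraj κ hGs (b := b)]
    · have : frestrictLe (π := fun _ => S) 0 (Function.update (fun _ : ℕ => s) 0 s') =
          fun _ => s' := by
        funext i
        obtain ⟨i, hi⟩ := i
        obtain rfl : i = 0 := by simpa using hi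
        simp
      rw [this]
      rfl
    · intro x y hxy
      simp only
      congr 1
      funext i
      obtain ⟨i, hi⟩ := i
      cases i with
      | zero => rfl
      | succ i => exact hxy i (by simpa using hi)
  · intro x y hxy
    simp only
    congr 1
    funext i
    exact hxy i i.2

lemma pathKernel_eq_consKernel : pathKernel κ = consKernel κ := by
  ext1 s
  rw [pathKernel, ← consKernel_eq_traj]
  rfl

/-- The Markov property at time one. -/
theorem lintegral_pathLaw (s : S) {g : (ℕ → S) → ENNReal} (hg : Measurable g) :
    ∫⁻ x, g x ∂(pathLaw κ s) =
      ∫⁻ s', ∫⁻ x, g (consPath s x) ∂(pathLaw κ s') ∂(κ s) := by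
  rw [← pathKernel_apply, pathKernel_eq_consKernel, lintegral_consKernel κ s hg]

lemma pathLaw_eq_map (s : S) :
    pathLaw κ s = ((pathKernel κ ∘ₖ κ) s).map (consPath s) := by
  refine Measure.ext_of_lintegral _ fun f hf => ?_
  have h : Measurable fun x : ℕ → S => f (consPath s x) := hf.comp (measurable_consPath s)
  rw [lintegral_pathLaw κ s hf, lintegral_map hf (measurable_consPath s),
    Kernel.lintegral_comp _ _ _ h]
  rfl

theorem integrable_consPath {s : S} {g : (ℕ → S) → ℝ} (hg : Integrable g (pathLaw κ s)) :
    (∀ᵐ s' ∂(κ s), Integrable (fun x => g (consPath s x)) (pathLaw κ s')) ∧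
      Integrable (fun s' => ∫ x, g (consPath s x) ∂(pathLaw κ s')) (κ s) := by
  rw [pathLaw_eq_map] at hg
  have h : Integrable (fun x => g (consPath s x)) ((pathKernel κ ∘ₖ κ) s) :=
    hg.comp_measurable (measurable_consPath s)
  exact ⟨((integrable_comp_iff h.aestronglyMeasurable).1 h).1, h.integral_comp⟩

theorem integral_pathLaw {s : S} {g : (ℕ → S) → ℝ} (hg : Integrable g (pathLaw κ s)) :
    ∫ x, g x ∂(pathLaw κ s) = ∫ s', ∫ x, g (consPath s x) ∂(pathLaw κ s') ∂(κ s) := by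
  rw [pathLaw_eq_map] at hg ⊢
  have h : Integrable (fun x => g (consPath s x)) ((pathKernel κ ∘ₖ κ) s) :=
    hg.comp_measurable (measurable_consPath s)
  rw [integral_map (measurable_consPath s).aemeasurable hg.aestronglyMeasurable,
    ProbabilityTheory.Kernel.integral_comp h]
  rfl

theorem ae_pathLaw_zero {s : S} {p : S → Prop} (hp : MeasurableSet {s | p s}) (hs : p s) :
    ∀ᵐ x ∂(pathLaw κ s), p (x 0) := by
  have h : MeasurableSet {x : ℕ → S | p (x 0)} := measurable_pi_apply 0 hp
  rw [pathLaw_eq_map, ae_map_iff (measurable_consPath s).aemeasurable h]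
  exact ae_of_all _ fun x => hs

end MarkovProperty

/-! ### The killed chain and a comparison principle for unbounded functions -/

section Killed

open Filter Topology ENNReal

variable {S : Type*} [MeasurableSpace S] (κ : Kernel S S) (D : Set S)

/-- One step of the chain with kernel `κ`, killed in `D`, acting on non-negative functions. -/
def killed (u : S → ℝ≥0∞) : S → ℝ≥0∞ := Dᶜ.indicator fun s => ∫⁻ s', u s' ∂(κ s)

variable {κ D}

lemma killed_of_mem {s : S} (hs : s ∈ D) (u : S → ℝ≥0∞) : killed κ D u s = 0 := by
  simp [killed, hs]

lemma killed_of_notMem {s : S} (hs : s ∉ D) (u : S → ℝ≥0∞) :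
    killed κ D u s = ∫⁻ s', u s' ∂(κ s) := by
  simp [killed, hs]

lemma killed_mono : Monotone (killed κ D) := by
  intro u v h s
  by_cases hs : s ∈ D
  · simp [killed_of_mem hs]
  · rw [killed_of_notMem hs, killed_of_notMem hs]
    exact lintegral_mono h

lemma measurable_killed (hD : MeasurableSet D) {u : S → ℝ≥0∞} (hu : Measurable u) :
    Measurable (killed κ D u) :=
  hu.lintegral_kernel.indicator hD.compl

lemma measurable_iterate_killed (hD : MeasurableSet D) {u : S → ℝ≥0∞} (hu : Measurable u) (t : ℕ) :
    Measurable ((killed κ D)^[t] u) := by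
  induction t with
  | zero => exact hu
  | succ t ih => rw [Function.iterate_succ_apply']; exact measurable_killed hD ih

lemma iterate_killed_le {u : S → ℝ≥0∞} (h : killed κ D u ≤ u) (t : ℕ) :
    (killed κ D)^[t] u ≤ u := by
  induction t with
  | zero => exact le_rfl
  | succ t ih => rw [Function.iterate_succ_apply']; exact (killed_mono ih).trans h

lemma le_iterate_killed {u : S → ℝ≥0∞} (h : u ≤ killed κ D u) (t : ℕ) :
    u ≤ (killed κ D)^[t] u := by
  induction t with
  | zero => exact le_rfl
  | succ t ih => rw [Function.iterate_succ_apply']; exact h.trans (killed_mono ih)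

lemma iterate_killed_add_le (hD : MeasurableSet D) {a b : ℝ≥0∞} (ha : a ≠ ⊤) (hb : b ≠ ⊤)
    {Ψ : S → ℝ≥0∞} (t : ℕ) (s : S) :
    (killed κ D)^[t] (fun s => a + b * Ψ s) s ≤
      a * (killed κ D)^[t] 1 s + b * (killed κ D)^[t] Ψ s := by
  induction t generalizing s with
  | zero => simp
  | succ t ih =>
    have h1 := measurable_iterate_killed (κ := κ) hD (measurable_one (α := ℝ≥0∞)) t
    simp only [Function.iterate_succ_apply']
    by_cases hs : s ∈ D
    · simp [killed_of_mem hs]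
    · rw [killed_of_notMem hs, killed_of_notMem hs, killed_of_notMem hs]
      refine (lintegral_mono ih).trans ?_
      rw [lintegral_add_left (h1.const_mul _), lintegral_const_mul' _ _ ha,
        lintegral_const_mul' _ _ hb]

/-- The function `W` is, up to constants, dominated by excessive functions that are small at any
given point. -/
def SmallTails (κ : Kernel S S) (D : Set S) (W : S → ℝ≥0∞) : Prop :=
  ∃ Ψ : ℕ → S → ℝ≥0∞, (∀ c, Measurable (Ψ c)) ∧ (∀ c, killed κ D (Ψ c) ≤ Ψ c) ∧
    (∀ s, Tendsto (fun c => Ψ c s) atTop (𝓝 0)) ∧ ∃ b : ℕ, ∀ c s, W s ≤ b * c + Ψ c s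

/-- Split `W` at level `c`. The constant part decays with the survival probability, and the rest
stays below the excessive function `Ψ c` at all times. Choose `c` first and `t` afterwards. -/
lemma SmallTails.tendsto_iterate_killed (hD : MeasurableSet D) {W u : S → ℝ≥0∞}
    (hW : SmallTails κ D W) {a b : ℝ≥0∞} (ha : a ≠ ⊤) (hb : b ≠ ⊤) (hu : ∀ s, u s ≤ a + b * W s)
    {s : S} (hs : Tendsto (fun t => (killed κ D)^[t] 1 s) atTop (𝓝 0)) :
    Tendsto (fun t => (killed κ D)^[t] u s) atTop (𝓝 0) := by
  obtain ⟨Ψ, hm, hex, hlim, k, hle⟩ := hW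
  have key : ∀ c : ℕ, ∀ t, (killed κ D)^[t] u s ≤
      (a + b * (k * c)) * (killed κ D)^[t] 1 s + b * Ψ c s := by
    intro c t
    have hmono : u ≤ fun s => (a + b * (k * c)) + b * Ψ c s := by
      intro s
      refine (hu s).trans ?_
      dsimp only
      rw [add_assoc, ← mul_add]
      gcongr
      exact hle c s
    refine ((killed_mono.iterate t) hmono s).trans ((iterate_killed_add_le hD ?_ hb t s).trans
      ?_)
    · exact ENNReal.add_ne_top.2 ⟨ha, ENNReal.mul_ne_top hb (by finiteness)⟩
    · gcongr
      exact iterate_killed_le (hex c) t s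
  rw [ENNReal.tendsto_nhds_zero]
  intro ε hε
  have h1 : Tendsto (fun c => b * Ψ c s) atTop (𝓝 0) := by
    simpa using ENNReal.Tendsto.const_mul (hlim s) (Or.inr hb)
  obtain ⟨c, hc⟩ := ((ENNReal.tendsto_nhds_zero.1 h1) (ε / 2) (by simpa using hε.ne')).exists
  have h2 : Tendsto (fun t => (a + b * (k * c)) * (killed κ D)^[t] 1 s) atTop (𝓝 0) := by
    simpa using ENNReal.Tendsto.const_mul hs (Or.inr (ENNReal.add_ne_top.2
      ⟨ha, ENNReal.mul_ne_top hb (by finiteness)⟩))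
  filter_upwards [(ENNReal.tendsto_nhds_zero.1 h2) (ε / 2) (by simpa using hε.ne')] with t ht
  calc _ ≤ _ := key c t
    _ ≤ ε / 2 + ε / 2 := add_le_add ht hc
    _ = ε := ENNReal.add_halves ε

/-- A subharmonic function of the killed chain that is controlled by small tails vanishes. -/
lemma SmallTails.eq_zero (hD : MeasurableSet D) {W u : S → ℝ≥0∞}
    (hW : SmallTails κ D W) {a b : ℝ≥0∞} (ha : a ≠ ⊤) (hb : b ≠ ⊤) (hu : ∀ s, u s ≤ a + b * W s)
    (hsub : u ≤ killed κ D u)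
    {s : S} (hs : Tendsto (fun t => (killed κ D)^[t] 1 s) atTop (𝓝 0)) : u s = 0 := by
  have h := hW.tendsto_iterate_killed hD ha hb hu hs
  exact le_antisymm (ge_of_tendsto' h fun t => le_iterate_killed hsub t s) bot_le

/-- The comparison principle for real functions. -/
lemma SmallTails.nonneg (hD : MeasurableSet D) {W : S → ℝ≥0∞} {d : S → ℝ}
    (hW : SmallTails κ D W) {a b : ℝ≥0∞} (ha : a ≠ ⊤) (hb : b ≠ ⊤) (hd : ∀ s, ‖d s‖ₑ ≤ a + b * W s)
    (hds : ∀ s ∈ D, 0 ≤ d s)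
    (hsuper : ∀ s ∉ D, 0 ≤ d s ∨ (Integrable d (κ s) ∧ ∫ s', d s' ∂(κ s) ≤ d s))
    {s : S} (hs : Tendsto (fun t => (killed κ D)^[t] 1 s) atTop (𝓝 0)) : 0 ≤ d s := by
  -- The negative part of `d` is subharmonic for the killed chain. It vanishes where `0 ≤ d`, so
  -- superharmonicity of `d` matters only where `d` is negative.
  have h0 : ENNReal.ofReal (-d s) = 0 := by
    refine hW.eq_zero (u := fun s => ENNReal.ofReal (-d s)) hD ha hb (fun s => ?_) (fun s => ?_) hs
    · refine le_trans ?_ (hd s)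
      rw [← enorm_neg, Real.enorm_eq_ofReal_abs]
      exact ENNReal.ofReal_le_ofReal (le_abs_self _)
    · by_cases hsD : s ∈ D
      · simp [ENNReal.ofReal_of_nonpos (neg_nonpos.2 (hds s hsD))]
      · rw [killed_of_notMem hsD]
        rcases hsuper s hsD with h | ⟨hi, h⟩
        · simp [ENNReal.ofReal_of_nonpos (neg_nonpos.2 h)]
        · calc ENNReal.ofReal (-d s) ≤ ENNReal.ofReal (∫ s', -d s' ∂(κ s)) := by
                apply ENNReal.ofReal_le_ofReal
                rw [integral_neg]
                linarith
            _ ≤ ENNReal.ofReal (∫ s', max (-d s') 0 ∂(κ s)) := by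
                apply ENNReal.ofReal_le_ofReal
                exact integral_mono hi.neg hi.neg.pos_part fun _ => le_max_left _ _
            _ = ∫⁻ s', ENNReal.ofReal (max (-d s') 0) ∂(κ s) :=
                ofReal_integral_eq_lintegral_ofReal hi.neg.pos_part
                  (ae_of_all _ fun _ => le_max_right _ _)
            _ = _ := by
                refine lintegral_congr fun s' => ?_
                rcases le_total (-d s') 0 with h | h
                · simp [h, ENNReal.ofReal_of_nonpos h]
                · simp [h]
  simpa using h0

end Killed

/-! ### Survival probabilities -/

section Termination

open Filter Topology ENNReal

variable {S : Type*} [MeasurableSpace S] {κ : Kernel S S} [IsMarkovKernel κ] {D : Set S}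

omit [MeasurableSpace S] in
lemma mem_timesBefore_consPath_zero {s : S} {x : ℕ → S} :
    0 ∈ timesBefore D (consPath s x) ↔ s ∉ D := by
  simp [timesBefore]

omit [MeasurableSpace S] in
lemma mem_timesBefore_consPath_succ {s : S} {x : ℕ → S} {t : ℕ} :
    t + 1 ∈ timesBefore D (consPath s x) ↔ s ∉ D ∧ t ∈ timesBefore D x := by
  constructor
  · intro h
    exact ⟨h 0 (by omega), fun u hu => h (u + 1) (by omega)⟩
  · rintro ⟨h0, h⟩ u hu
    cases u with
    | zero => exact h0
    | succ u => exact h u (by omega)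

omit [MeasurableSpace S] in
lemma indicator_timesBefore_consPath_zero {β : Type*} [Zero β] {s : S} (hs : s ∉ D) (x : ℕ → S)
    (g : ℕ → β) : (timesBefore D (consPath s x)).indicator g 0 = g 0 :=
  Set.indicator_of_mem (mem_timesBefore_consPath_zero.2 hs) _

omit [MeasurableSpace S] in
lemma indicator_timesBefore_consPath_succ {β : Type*} [Zero β] {s : S} (hs : s ∉ D) (x : ℕ → S)
    (g : ℕ → β) (t : ℕ) : (timesBefore D (consPath s x)).indicator g (t + 1) =
      (timesBefore D x).indicator (fun t => g (t + 1)) t := by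
  by_cases ht : t ∈ timesBefore D x
  · rw [Set.indicator_of_mem ht, Set.indicator_of_mem (mem_timesBefore_consPath_succ.2 ⟨hs, ht⟩)]
  · rw [Set.indicator_of_notMem ht,
      Set.indicator_of_notMem fun h => ht (mem_timesBefore_consPath_succ.1 h).2]

omit [MeasurableSpace S] in
lemma indicator_timesBefore_consPath_of_mem {β : Type*} [Zero β] {s : S} (hs : s ∈ D) (x : ℕ → S)
    (g : ℕ → β) (t : ℕ) : (timesBefore D (consPath s x)).indicator g t = 0 := by
  exact Set.indicator_of_notMem (fun h : t ∈ timesBefore D (consPath s x) => h 0 t.zero_le hs) _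

lemma measurableSet_mem_timesBefore (hD : MeasurableSet D) (t : ℕ) :
    MeasurableSet {x : ℕ → S | t ∈ timesBefore D x} := by
  have : {x : ℕ → S | t ∈ timesBefore D x} = ⋂ u ∈ Set.Iic t, (fun x : ℕ → S => x u) ⁻¹' Dᶜ := by
    ext x; simp [timesBefore]
  rw [this]
  exact MeasurableSet.biInter (Set.to_countable _) fun u _ => measurable_pi_apply u hD.compl

/-- Surviving time `t` means avoiding `D` at the `t + 1` times `0, …, t`, and each application of
`killed` tests one of them. -/
lemma pathLaw_mem_timesBefore (hD : MeasurableSet D) (t : ℕ) (s : S) :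
    pathLaw κ s {x | t ∈ timesBefore D x} = (killed κ D)^[t + 1] 1 s := by
  induction t generalizing s with
  | zero =>
    have hm := measurableSet_mem_timesBefore hD 0
    rw [← lintegral_indicator_one hm, lintegral_pathLaw κ s (measurable_one.indicator hm)]
    by_cases hs : s ∈ D
    · simp [killed_of_mem hs, Set.indicator, mem_timesBefore_consPath_zero, hs]
    · simp [killed_of_notMem hs, Set.indicator, mem_timesBefore_consPath_zero, hs]
  | succ t ih =>
    have hm := measurableSet_mem_timesBefore hD (t + 1)
    rw [← lintegral_indicator_one hm, lintegral_pathLaw κ s (measurable_one.indicator hm),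
      Function.iterate_succ_apply']
    by_cases hs : s ∈ D
    · simp [killed_of_mem hs, Set.indicator, mem_timesBefore_consPath_succ, hs]
    · rw [killed_of_notMem hs]
      refine lintegral_congr fun s' => ?_
      rw [← ih s', ← lintegral_indicator_one (measurableSet_mem_timesBefore hD t)]
      refine lintegral_congr fun x => ?_
      exact indicator_timesBefore_consPath_succ hs x 1 t

lemma ae_exists_mem_iff (hD : MeasurableSet D) (s : S) :
    (∀ᵐ x ∂(pathLaw κ s), ∃ t, x t ∈ D) ↔
      Tendsto (fun t => (killed κ D)^[t] 1 s) atTop (𝓝 0) := by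
  have hset : {x : ℕ → S | ¬ ∃ t, x t ∈ D} = ⋂ t, {x | t ∈ timesBefore D x} := by
    ext x
    simp only [timesBefore, not_exists, Set.mem_ofPred_eq, Set.mem_iInter]
    exact ⟨fun h t u _ => h u, fun h t => h t t le_rfl⟩
  have hanti : Antitone fun t => {x : ℕ → S | t ∈ timesBefore D x} :=
    fun t t' htt x hx u hu => hx u (hu.trans htt)
  have hlim := tendsto_measure_iInter_atTop (μ := pathLaw κ s)
    (fun t => (measurableSet_mem_timesBefore (S := S) hD t).nullMeasurableSet) hanti
    ⟨0, measure_ne_top _ _⟩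
  simp only [Function.comp_def, pathLaw_mem_timesBefore hD] at hlim
  rw [ae_iff, hset, ← tendsto_add_atTop_iff_nat (f := fun t => (killed κ D)^[t] 1 s) 1]
  constructor
  · intro h
    rwa [h] at hlim
  · intro h
    exact tendsto_nhds_unique hlim h

end Termination

/-! ### Totals along a trajectory -/

section Total

open Filter Topology ENNReal

variable {S : Type*} [MeasurableSpace S] {κ : Kernel S S} [IsMarkovKernel κ] {D : Set S} {f : S → ℝ}

/-- The sum of the absolute values of `f` along a trajectory until it hits `D`. -/
def absTotal (D : Set S) (f : S → ℝ) (x : ℕ → S) : ℝ≥0∞ :=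
  ∑' t, (timesBefore D x).indicator (fun t => ‖f (x t)‖ₑ) t

/-- The expected value of `absTotal`. -/
def absValue (κ : Kernel S S) [IsMarkovKernel κ] (D : Set S) (f : S → ℝ) (s : S) : ℝ≥0∞ :=
  ∫⁻ x, absTotal D f x ∂(pathLaw κ s)

lemma measurable_indicator_timesBefore {β : Type*} [MeasurableSpace β] [Zero β]
    (hD : MeasurableSet D) {g : S → β} (hg : Measurable g) (t : ℕ) :
    Measurable fun x : ℕ → S => (timesBefore D x).indicator (fun t => g (x t)) t := by
  have : (fun x : ℕ → S => (timesBefore D x).indicator (fun t => g (x t)) t) =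
      {x : ℕ → S | t ∈ timesBefore D x}.indicator fun x => g (x t) := by
    ext x; simp [Set.indicator]
  rw [this]
  exact (hg.comp (measurable_pi_apply t)).indicator (measurableSet_mem_timesBefore hD t)

lemma measurable_absTotal (hD : MeasurableSet D) (hf : Measurable f) :
    Measurable (absTotal D f) :=
  Measurable.tsum fun t => measurable_indicator_timesBefore hD hf.enorm t

omit [MeasurableSpace S] in
lemma absTotal_consPath_of_mem {s : S} (hs : s ∈ D) (x : ℕ → S) :
    absTotal D f (consPath s x) = 0 := by
  exact ENNReal.tsum_eq_zero.2 fun t => indicator_timesBefore_consPath_of_mem hs x _ t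

omit [MeasurableSpace S] in
lemma absTotal_consPath_of_notMem {s : S} (hs : s ∉ D) (x : ℕ → S) :
    absTotal D f (consPath s x) = ‖f s‖ₑ + absTotal D f x := by
  rw [absTotal, tsum_eq_zero_add' ENNReal.summable]
  rw [indicator_timesBefore_consPath_zero hs]
  simp only [indicator_timesBefore_consPath_succ hs]
  rfl

lemma absValue_of_mem (hD : MeasurableSet D) (hf : Measurable f) {s : S} (hs : s ∈ D) :
    absValue κ D f s = 0 := by
  rw [absValue, lintegral_pathLaw κ s (measurable_absTotal hD hf)]
  simp [absTotal_consPath_of_mem hs]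

lemma measurable_lintegral_pathLaw {g : (ℕ → S) → ℝ≥0∞} (hg : Measurable g) :
    Measurable fun s => ∫⁻ x, g x ∂(pathLaw κ s) :=
  hg.lintegral_kernel (κ := pathKernel κ)

lemma measurable_absValue (hD : MeasurableSet D) (hf : Measurable f) :
    Measurable (absValue κ D f) :=
  measurable_lintegral_pathLaw (measurable_absTotal hD hf)

lemma absValue_of_notMem (hD : MeasurableSet D) (hf : Measurable f) {s : S} (hs : s ∉ D) :
    absValue κ D f s = ‖f s‖ₑ + ∫⁻ s', absValue κ D f s' ∂(κ s) := by
  rw [absValue, lintegral_pathLaw κ s (measurable_absTotal hD hf)]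
  simp only [absTotal_consPath_of_notMem hs]
  simp only [lintegral_add_left measurable_const, lintegral_const, measure_univ, mul_one]
  rfl

/-- The expected total is the least supersolution: unrolling the inequality bounds every partial sum
by `W`, and monotone convergence does the rest. Nothing is assumed finite, so this can serve to
prove integrability. -/
lemma absValue_le (hD : MeasurableSet D) (hf : Measurable f) {W : S → ℝ≥0∞}
    (hW : ∀ s ∉ D, ‖f s‖ₑ + ∫⁻ s', W s' ∂(κ s) ≤ W s) (s : S) : absValue κ D f s ≤ W s := by
  have hmeas : ∀ N, Measurable fun x : ℕ → S => ∑ t ∈ Finset.range N,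
      (timesBefore D x).indicator (fun t => ‖f (x t)‖ₑ) t := fun N =>
    Finset.measurable_sum _ fun t _ => measurable_indicator_timesBefore hD hf.enorm t
  have key : ∀ N s, ∫⁻ x, ∑ t ∈ Finset.range N,
      (timesBefore D x).indicator (fun t => ‖f (x t)‖ₑ) t ∂(pathLaw κ s) ≤ W s := by
    intro N
    induction N with
    | zero => simp
    | succ N ih =>
      intro s
      rw [lintegral_pathLaw κ s (hmeas _)]
      by_cases hs : s ∈ D
      · refine le_trans (le_of_eq ?_) bot_le
        simp [indicator_timesBefore_consPath_of_mem hs]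
      · refine le_trans ?_ (hW s hs)
        have : ∀ x, ∑ t ∈ Finset.range (N + 1),
            (timesBefore D (consPath s x)).indicator (fun t => ‖f (consPath s x t)‖ₑ) t =
            ‖f s‖ₑ + ∑ t ∈ Finset.range N,
              (timesBefore D x).indicator (fun t => ‖f (x t)‖ₑ) t := by
          intro x
          rw [Finset.sum_range_succ', add_comm, indicator_timesBefore_consPath_zero hs]
          simp only [indicator_timesBefore_consPath_succ hs]
          rfl
        simp only [this, lintegral_add_left measurable_const, lintegral_const, measure_univ,
          mul_one]
        gcongr
        exact ih _
  have hmono : Monotone fun N => fun x : ℕ → S => ∑ t ∈ Finset.range N,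
      (timesBefore D x).indicator (fun t => ‖f (x t)‖ₑ) t := fun N N' h x =>
    Finset.sum_le_sum_of_subset (Finset.range_mono h)
  simp only [absValue, absTotal, ENNReal.tsum_eq_iSup_nat]
  rw [lintegral_iSup hmeas hmono]
  exact iSup_le fun N => key N s

lemma TerminatesIntegrably.tendsto (hD : MeasurableSet D) {s : S}
    (h : TerminatesIntegrably κ D f s) :
    Tendsto (fun t => (killed κ D)^[t] 1 s) atTop (𝓝 0) := (ae_exists_mem_iff hD s).1 h.1

lemma TerminatesIntegrably.absValue_lt_top {s : S} (h : TerminatesIntegrably κ D f s) :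
    absValue κ D f s < ⊤ := h.2

/-- The tails of `absTotal` are small excessive functions. -/
lemma smallTails_absValue (hD : MeasurableSet D) (hf : Measurable f)
    (h : ∀ s, TerminatesIntegrably κ D f s) : SmallTails κ D (absValue κ D f) := by
  have hT := measurable_absTotal hD hf
  -- `Ψ c` is the expected excess of the total over `c`. Dropping the first reward can only lower
  -- the excess, which makes `Ψ c` excessive; dominated convergence sends it to zero.
  refine ⟨fun c s => ∫⁻ x, absTotal D f x - c ∂(pathLaw κ s), fun c =>
    measurable_lintegral_pathLaw (hT.sub_const _), fun c s => ?_, fun s => ?_, 1, fun c s => ?_⟩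
  · by_cases hs : s ∈ D
    · simp [killed_of_mem hs]
    · rw [killed_of_notMem hs]
      dsimp only
      rw [lintegral_pathLaw κ s (hT.sub_const _)]
      refine lintegral_mono fun s' => lintegral_mono fun x => ?_
      dsimp only
      rw [absTotal_consPath_of_notMem hs]
      gcongr
      exact le_add_self
  · have hfin : ∀ᵐ x ∂(pathLaw κ s), absTotal D f x < ⊤ :=
      ae_lt_top hT (h s).absValue_lt_top.ne
    have := tendsto_lintegral_of_dominated_convergence (μ := pathLaw κ s)
      (F := fun (c : ℕ) x => absTotal D f x - c) (f := fun _ => 0) (absTotal D f)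
      (fun c => hT.sub_const _) (fun c => ae_of_all _ fun x => tsub_le_self)
      (h s).absValue_lt_top.ne ?_
    · simpa using this
    · filter_upwards [hfin] with x hx
      obtain ⟨n, hn⟩ := ENNReal.exists_nat_gt hx.ne
      refine tendsto_const_nhds.congr' ?_
      filter_upwards [eventually_ge_atTop n] with c hc
      refine (tsub_eq_zero_of_le (hn.le.trans ?_)).symm
      exact_mod_cast hc
  · calc absValue κ D f s ≤ ∫⁻ x, c + (absTotal D f x - c) ∂(pathLaw κ s) :=
          lintegral_mono fun x => le_add_tsub
      _ = _ := by
          rw [lintegral_add_left measurable_const]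
          simp

omit [MeasurableSpace S] in
lemma summable_of_absTotal_lt_top {x : ℕ → S} (hx : absTotal D f x ≠ ⊤) :
    Summable fun t => (timesBefore D x).indicator (fun t => f (x t)) t := by
  apply Summable.of_norm
  refine (ENNReal.summable_toReal hx).congr fun t => ?_
  by_cases ht : t ∈ timesBefore D x <;> simp [ht]

omit [MeasurableSpace S] in
lemma enorm_totalBefore_le (x : ℕ → S) : ‖totalBefore D f x‖ₑ ≤ absTotal D f x := by
  refine enorm_tsum_le_tsum_enorm.trans (le_of_eq (tsum_congr fun t => ?_))
  by_cases ht : t ∈ timesBefore D x <;> simp [ht]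

omit [MeasurableSpace S] in
lemma totalBefore_consPath_of_mem {s : S} (hs : s ∈ D) (x : ℕ → S) :
    totalBefore D f (consPath s x) = 0 := by
  exact (tsum_congr fun t => indicator_timesBefore_consPath_of_mem hs x _ t).trans tsum_zero

omit [MeasurableSpace S] in
lemma totalBefore_consPath_of_notMem {s : S} (hs : s ∉ D) {x : ℕ → S}
    (hx : absTotal D f x ≠ ⊤) :
    totalBefore D f (consPath s x) = f s + totalBefore D f x := by
  rw [totalBefore, Summable.tsum_eq_zero_add]
  · rw [indicator_timesBefore_consPath_zero hs]
    simp only [indicator_timesBefore_consPath_succ hs]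
    rfl
  · apply summable_of_absTotal_lt_top
    rw [absTotal_consPath_of_notMem hs]
    exact ENNReal.add_ne_top.2 ⟨enorm_ne_top, hx⟩

lemma TerminatesIntegrably.ae_absTotal_ne_top (hD : MeasurableSet D) (hf : Measurable f) {s : S}
    (h : TerminatesIntegrably κ D f s) : ∀ᵐ x ∂(pathLaw κ s), absTotal D f x ≠ ⊤ := by
  filter_upwards [ae_lt_top (measurable_absTotal hD hf) h.absValue_lt_top.ne] with x hx using hx.ne

lemma TerminatesIntegrably.integrable_totalBefore (hD : MeasurableSet D) (hf : Measurable f) {s : S}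
    (h : TerminatesIntegrably κ D f s) : Integrable (totalBefore D f) (pathLaw κ s) := by
  refine ⟨?_, lt_of_le_of_lt (lintegral_mono fun x => enorm_totalBefore_le x) h.absValue_lt_top⟩
  refine aestronglyMeasurable_of_tendsto_ae (u := atTop) (f := fun N x => ∑ t ∈ Finset.range N,
    (timesBefore D x).indicator (fun t => f (x t)) t) (fun N => ?_) ?_
  · exact (Finset.measurable_sum _ fun t _ =>
      measurable_indicator_timesBefore hD hf t).aestronglyMeasurable
  · filter_upwards [h.ae_absTotal_ne_top hD hf] with x hx
    exact (summable_of_absTotal_lt_top hx).hasSum.tendsto_sum_nat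

/-- The expected total of `f`. -/
def totalValue (κ : Kernel S S) [IsMarkovKernel κ] (D : Set S) (f : S → ℝ) (s : S) : ℝ :=
  ∫ x, totalBefore D f x ∂(pathLaw κ s)

lemma enorm_totalValue_le (s : S) : ‖totalValue κ D f s‖ₑ ≤ absValue κ D f s :=
  (enorm_integral_le_lintegral_enorm _).trans (lintegral_mono fun x => enorm_totalBefore_le x)

lemma totalValue_of_mem (hD : MeasurableSet D) (hf : Measurable f) {s : S}
    (h : TerminatesIntegrably κ D f s) (hs : s ∈ D) : totalValue κ D f s = 0 := by
  rw [totalValue, integral_pathLaw κ (h.integrable_totalBefore hD hf)]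
  simp [totalBefore_consPath_of_mem hs]

lemma totalValue_step (hD : MeasurableSet D) (hf : Measurable f)
    (h : ∀ s, TerminatesIntegrably κ D f s) {s : S} (hs : s ∉ D) :
    Integrable (totalValue κ D f) (κ s) ∧
      totalValue κ D f s = f s + ∫ s', totalValue κ D f s' ∂(κ s) := by
  have h2 : ∀ s', ∫ x, totalBefore D f (consPath s x) ∂(pathLaw κ s') =
      f s + totalValue κ D f s' := by
    intro s'
    rw [integral_congr_ae (g := fun x => f s + totalBefore D f x),
      integral_add (integrable_const _) ((h s').integrable_totalBefore hD hf)]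
    · simp [totalValue]
    · filter_upwards [(h s').ae_absTotal_ne_top hD hf] with x hx
      exact totalBefore_consPath_of_notMem hs hx
  have hint := (h s).integrable_totalBefore hD hf
  have h1 := (integrable_consPath κ hint).2
  simp only [h2] at h1
  have h3 : Integrable (totalValue κ D f) (κ s) := by
    refine (h1.sub (integrable_const (f s))).congr (ae_of_all _ fun s' => ?_)
    simp
  refine ⟨h3, ?_⟩
  rw [totalValue, integral_pathLaw κ hint]
  simp only [h2]
  rw [integral_add (integrable_const _) h3]
  simp

end Total

/-! ### Verification theorems -/

section Verification

open Filter Topology ENNReal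

variable {S : Type*} [MeasurableSpace S] {κ : Kernel S S} [IsMarkovKernel κ] {D : Set S} {f : S → ℝ}

omit [MeasurableSpace S] in
lemma enorm_sub_le_of_le {a b : ℝ≥0∞} {W : S → ℝ≥0∞} {u v : S → ℝ} {s : S}
    (hu : ‖u s‖ₑ ≤ a + b * W s) (hv : ‖v s‖ₑ ≤ a + b * W s) :
    ‖u s - v s‖ₑ ≤ 2 * a + 2 * b * W s := by
  refine enorm_sub_le.trans ((add_le_add hu hv).trans (le_of_eq ?_))
  ring

/-- A superharmonic function dominates the expected total reward. -/
theorem totalValue_le (hD : MeasurableSet D) (hf : Measurable f)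
    (h : ∀ s, TerminatesIntegrably κ D f s) {W : S → ℝ≥0∞} (hW : SmallTails κ D W)
    {a b : ℝ≥0∞} (ha : a ≠ ⊤) (hb : b ≠ ⊤) (habs : ∀ s, absValue κ D f s ≤ a + b * W s)
    {v : S → ℝ} (hv : ∀ s, ‖v s‖ₑ ≤ a + b * W s) (hv0 : ∀ s ∈ D, v s = 0)
    (hstep : ∀ s ∉ D, Integrable v (κ s) ∧ f s + ∫ s', v s' ∂(κ s) ≤ v s) (s : S) :
    totalValue κ D f s ≤ v s := by
  have := hW.nonneg (d := fun s => v s - totalValue κ D f s) (a := 2 * a) (b := 2 * b) hD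
    (by finiteness) (by finiteness)
    (fun s => enorm_sub_le_of_le (hv s) ((enorm_totalValue_le s).trans (habs s)))
    (fun s hs => by simp [hv0 s hs, totalValue_of_mem hD hf (h s) hs])
    (fun s hs => Or.inr ?_) ((h s).tendsto hD)
  · exact sub_nonneg.1 this
  · obtain ⟨h1, h2⟩ := totalValue_step hD hf h hs
    obtain ⟨h3, h4⟩ := hstep s hs
    refine ⟨h3.sub h1, ?_⟩
    rw [integral_sub h3 h1, h2]
    linarith

/-- A subharmonic function is dominated by the expected total reward. -/
theorem le_totalValue (hD : MeasurableSet D) (hf : Measurable f)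
    (h : ∀ s, TerminatesIntegrably κ D f s) {W : S → ℝ≥0∞} (hW : SmallTails κ D W)
    {a b : ℝ≥0∞} (ha : a ≠ ⊤) (hb : b ≠ ⊤) (habs : ∀ s, absValue κ D f s ≤ a + b * W s)
    {v : S → ℝ} (hv : ∀ s, ‖v s‖ₑ ≤ a + b * W s) (hv0 : ∀ s ∈ D, v s = 0)
    (hstep : ∀ s ∉ D, Integrable v (κ s) ∧ v s ≤ f s + ∫ s', v s' ∂(κ s)) (s : S) :
    v s ≤ totalValue κ D f s := by
  have := hW.nonneg (d := fun s => totalValue κ D f s - v s) (a := 2 * a) (b := 2 * b) hD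
    (by finiteness) (by finiteness)
    (fun s => enorm_sub_le_of_le ((enorm_totalValue_le s).trans (habs s)) (hv s))
    (fun s hs => by simp [hv0 s hs, totalValue_of_mem hD hf (h s) hs])
    (fun s hs => Or.inr ?_) ((h s).tendsto hD)
  · exact sub_nonneg.1 this
  · obtain ⟨h1, h2⟩ := totalValue_step hD hf h hs
    obtain ⟨h3, h4⟩ := hstep s hs
    refine ⟨h1.sub h3, ?_⟩
    rw [integral_sub h1 h3, h2]
    linarith

end Verification

/-! ### A single terminating chain -/

namespace RewardChain

open Filter Topology ENNReal

variable {S : Type*} [MeasurableSpace S] (C : RewardChain S)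

/-- Every initial state of the chain terminates integrably. -/
def Terminating : Prop := ∀ s, TerminatesIntegrably C.kernel C.terminal C.reward s

/-- The expected sum of the absolute values of the rewards. -/
def weight (s : S) : ℝ := (absValue C.kernel C.terminal C.reward s).toReal

variable {C} (hC : C.Terminating)

include hC in
lemma Terminating.ofReal_weight (s : S) :
    ENNReal.ofReal (C.weight s) = absValue C.kernel C.terminal C.reward s :=
  ENNReal.ofReal_toReal (hC s).absValue_lt_top.ne

lemma weight_nonneg (s : S) : 0 ≤ C.weight s := ENNReal.toReal_nonneg

lemma measurable_weight : Measurable C.weight :=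
  (measurable_absValue C.measurableSet_terminal C.measurable_reward).ennreal_toReal

lemma weight_of_mem {s : S} (hs : s ∈ C.terminal) : C.weight s = 0 := by
  simp [weight, absValue_of_mem C.measurableSet_terminal C.measurable_reward hs]

include hC in
lemma Terminating.integrable_weight (s : S) : Integrable C.weight (C.kernel s) := by
  by_cases hs : s ∈ C.terminal
  · rw [C.absorbing s hs]
    exact integrable_dirac' measurable_weight.stronglyMeasurable (by simp)
  · refine integrable_toReal_of_lintegral_ne_top
      (measurable_absValue C.measurableSet_terminal C.measurable_reward).aemeasurable ?_
    have h := (hC s).absValue_lt_top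
    rw [absValue_of_notMem C.measurableSet_terminal C.measurable_reward hs] at h
    exact (lt_of_le_of_lt le_add_self h).ne

include hC in
lemma Terminating.weight_eq {s : S} (hs : s ∉ C.terminal) :
    C.weight s = |C.reward s| + ∫ s', C.weight s' ∂(C.kernel s) := by
  have h := (hC s).absValue_lt_top
  have h' := absValue_of_notMem (κ := C.kernel) C.measurableSet_terminal C.measurable_reward hs
  rw [weight, h', ENNReal.toReal_add enorm_ne_top (by
    rw [h'] at h; exact (lt_of_le_of_lt le_add_self h).ne)]
  rw [toReal_enorm, Real.norm_eq_abs, ← integral_toReal (measurable_absValue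
    C.measurableSet_terminal C.measurable_reward).aemeasurable
    (ae_of_all _ fun s' => (hC s').absValue_lt_top)]
  rfl

include hC in
lemma Terminating.integrable_of_abs_le {v : S → ℝ} (hv : Measurable v) {a b : ℝ}
    (h : ∀ s, |v s| ≤ a + b * C.weight s) (s : S) : Integrable v (C.kernel s) :=
  ((integrable_const a).add ((hC.integrable_weight s).const_mul b)).mono' hv.aestronglyMeasurable
    (ae_of_all _ h)

include hC in
lemma Terminating.smallTails : SmallTails C.kernel C.terminal
    (fun s => ENNReal.ofReal (C.weight s)) := by
  simp only [hC.ofReal_weight]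
  exact smallTails_absValue C.measurableSet_terminal C.measurable_reward hC

include hC in
/-- The comparison principle on a terminating chain. -/
lemma Terminating.nonneg {d : S → ℝ} {a b : ℝ} (ha : 0 ≤ a) (hb : 0 ≤ b)
    (hd : ∀ s, |d s| ≤ a + b * C.weight s) (hds : ∀ s ∈ C.terminal, 0 ≤ d s)
    (hsuper : ∀ s ∉ C.terminal, 0 ≤ d s ∨
      (Integrable d (C.kernel s) ∧ ∫ s', d s' ∂(C.kernel s) ≤ d s)) (s : S) : 0 ≤ d s := by
  refine hC.smallTails.nonneg (a := ENNReal.ofReal a) (b := ENNReal.ofReal b)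
    C.measurableSet_terminal ofReal_ne_top ofReal_ne_top (fun s => ?_) hds hsuper
    ((hC s).tendsto C.measurableSet_terminal)
  rw [← ENNReal.ofReal_mul hb, ← ENNReal.ofReal_add ha (mul_nonneg hb (weight_nonneg s)),
    Real.enorm_eq_ofReal_abs]
  exact ENNReal.ofReal_le_ofReal (hd s)

/-! ### Value iteration in the local MDP -/

variable (C) in
open Classical in
/-- The Bellman operator of the local MDP. -/
def stopStep (α : ℝ) (v : S → ℝ) (s : S) : ℝ :=
  if s ∈ C.terminal then 0 else max α (C.reward s + ∫ s', v s' ∂(C.kernel s))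

variable (C) in
open Classical in
/-- The optimal value of the local MDP with at most `k` steps of the chain. -/
def stopIter (α : ℝ) : ℕ → S → ℝ
  | 0 => fun s => if s ∈ C.terminal then 0 else α
  | k + 1 => C.stopStep α (stopIter α k)

lemma measurable_stopStep (α : ℝ) {v : S → ℝ} (hv : Measurable v) :
    Measurable (C.stopStep α v) :=
  Measurable.ite C.measurableSet_terminal measurable_const
    (measurable_const.max (C.measurable_reward.add
      hv.stronglyMeasurable.integral_kernel.measurable))

lemma measurable_stopIter (α : ℝ) (k : ℕ) : Measurable (C.stopIter α k) := by
  induction k with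
  | zero => exact Measurable.ite C.measurableSet_terminal measurable_const measurable_const
  | succ k ih => exact measurable_stopStep α ih

lemma stopIter_of_mem (α : ℝ) (k : ℕ) {s : S} (hs : s ∈ C.terminal) : C.stopIter α k s = 0 := by
  cases k <;> simp [stopIter, stopStep, hs]

include hC in
-- The bound reproduces itself because the weight is `|C.reward s|` plus its own average over the
-- next state.
lemma Terminating.abs_stopStep_le {α : ℝ} {v : S → ℝ} (hv : Measurable v)
    (h : ∀ s, |v s| ≤ |α| + 1 * C.weight s) (s : S) :
    |C.stopStep α v s| ≤ |α| + 1 * C.weight s := by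
  by_cases hs : s ∈ C.terminal
  · simp only [stopStep, hs, if_true, abs_zero]
    have := weight_nonneg (C := C) s
    positivity
  · simp only [stopStep, hs, if_false]
    have h1 : |∫ s', v s' ∂(C.kernel s)| ≤ |α| + ∫ s', C.weight s' ∂(C.kernel s) := by
      refine (abs_integral_le_integral_abs).trans ?_
      refine (integral_mono (hC.integrable_of_abs_le hv h s).abs
        ((integrable_const _).add ((hC.integrable_weight s).const_mul 1)) h).trans (le_of_eq ?_)
      simp only [Pi.add_apply]
      rw [integral_add (integrable_const _) ((hC.integrable_weight s).const_mul 1)]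
      simp
    have h2 := hC.weight_eq hs
    have h3 := weight_nonneg (C := C) s
    have h4 := abs_le.1 h1
    have h5 := neg_abs_le (C.reward s)
    have h6 := le_abs_self (C.reward s)
    have h7 := neg_abs_le α
    have h8 := le_abs_self α
    rw [abs_le]
    constructor
    · exact le_trans (by linarith) (le_max_left _ _)
    · exact max_le (by linarith) (by linarith)

include hC in
lemma Terminating.abs_stopIter_le (α : ℝ) (k : ℕ) (s : S) :
    |C.stopIter α k s| ≤ |α| + 1 * C.weight s := by
  induction k generalizing s with
  | zero =>
    have := weight_nonneg (C := C) s
    simp only [stopIter]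
    split_ifs
    · simp only [abs_zero]; positivity
    · linarith
  | succ k ih => exact hC.abs_stopStep_le (measurable_stopIter α k) ih s

include hC in
lemma Terminating.integrable_stopIter (α : ℝ) (k : ℕ) (s : S) :
    Integrable (C.stopIter α k) (C.kernel s) :=
  hC.integrable_of_abs_le (measurable_stopIter α k) (hC.abs_stopIter_le α k) s

include hC in
lemma Terminating.stopIter_le_succ (α : ℝ) (k : ℕ) (s : S) :
    C.stopIter α k s ≤ C.stopIter α (k + 1) s := by
  induction k generalizing s with
  | zero =>
    simp only [stopIter, stopStep]
    split_ifs
    · exact le_rfl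
    · exact le_max_left _ _
  | succ k ih =>
    rw [stopIter, stopIter, stopStep, stopStep]
    split_ifs
    · exact le_rfl
    · exact max_le_max le_rfl (add_le_add le_rfl (integral_mono (hC.integrable_stopIter α k s)
        (hC.integrable_stopIter α (k + 1) s) ih))

variable (C) in
/-- The limit of value iteration in the local MDP. -/
def stopValue (α : ℝ) (s : S) : ℝ := ⨆ k, C.stopIter α k s

include hC in
lemma Terminating.tendsto_stopIter (α : ℝ) (s : S) :
    Tendsto (fun k => C.stopIter α k s) atTop (𝓝 (C.stopValue α s)) := by
  refine tendsto_atTop_ciSup (monotone_nat_of_le_succ fun k => hC.stopIter_le_succ α k s) ?_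
  refine ⟨|α| + 1 * C.weight s, ?_⟩
  rintro _ ⟨k, rfl⟩
  exact (le_abs_self _).trans (hC.abs_stopIter_le α k s)

lemma measurable_stopValue (α : ℝ) : Measurable (C.stopValue α) :=
  Measurable.iSup fun k => measurable_stopIter α k

include hC in
lemma Terminating.abs_stopValue_le (α : ℝ) (s : S) :
    |C.stopValue α s| ≤ |α| + 1 * C.weight s :=
  le_of_tendsto' (hC.tendsto_stopIter α s).abs fun k => hC.abs_stopIter_le α k s

include hC in
lemma Terminating.integrable_stopValue (α : ℝ) (s : S) :
    Integrable (C.stopValue α) (C.kernel s) :=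
  hC.integrable_of_abs_le (measurable_stopValue α) (hC.abs_stopValue_le α) s

lemma stopValue_of_mem (α : ℝ) {s : S} (hs : s ∈ C.terminal) : C.stopValue α s = 0 := by
  simp [stopValue, stopIter_of_mem α _ hs]

include hC in
lemma Terminating.stopValue_of_notMem (α : ℝ) {s : S} (hs : s ∉ C.terminal) :
    C.stopValue α s = max α (C.reward s + ∫ s', C.stopValue α s' ∂(C.kernel s)) := by
  have h1 := (tendsto_add_atTop_iff_nat 1).2 (hC.tendsto_stopIter α s)
  have h2 : Tendsto (fun k => ∫ s', C.stopIter α k s' ∂(C.kernel s)) atTop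
      (𝓝 (∫ s', C.stopValue α s' ∂(C.kernel s))) := by
    refine tendsto_integral_of_dominated_convergence (fun s => |α| + 1 * C.weight s)
      (fun k => (measurable_stopIter α k).aestronglyMeasurable)
      ((integrable_const _).add ((hC.integrable_weight s).const_mul 1))
      (fun k => ae_of_all _ fun s' => hC.abs_stopIter_le α k s')
      (ae_of_all _ fun s' => hC.tendsto_stopIter α s')
  have h3 := (tendsto_const_nhds (x := α)).max ((tendsto_const_nhds (x := C.reward s)).add h2)
  refine tendsto_nhds_unique h1 (h3.congr fun k => ?_)
  simp [stopIter, stopStep, hs]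

/-! ### The local MDP -/

section LocalMDP

variable (α : ℝ) (π : Policy (S ⊕ Unit) LocalAction)

lemma localMDP_policyKernel_go {s : S} (h : π.1 (Sum.inl s) = LocalAction.go) :
    (C.localMDP α).policyKernel π (Sum.inl s) = (C.kernel s).map Sum.inl := by
  change C.localKernel (Sum.inl s, π.1 (Sum.inl s)) = _
  rw [h]; rfl

lemma localMDP_policyKernel_quit {s : S} (h : π.1 (Sum.inl s) = LocalAction.quit) :
    (C.localMDP α).policyKernel π (Sum.inl s) = Measure.dirac (Sum.inr ()) := by
  change C.localKernel (Sum.inl s, π.1 (Sum.inl s)) = _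
  rw [h]; rfl

lemma inl_mem_localMDP_terminal {s : S} :
    Sum.inl s ∈ (C.localMDP α).terminal ↔ s ∈ C.terminal := by
  simp [localMDP]

lemma inr_mem_localMDP_terminal (u : Unit) : Sum.inr u ∈ (C.localMDP α).terminal := by
  simp [localMDP]

lemma localMDP_policyReward_go {s : S} (h : π.1 (Sum.inl s) = LocalAction.go) :
    (C.localMDP α).policyReward π (Sum.inl s) = C.reward s := by
  change C.localReward α (Sum.inl s) (π.1 (Sum.inl s)) = _
  rw [h]; rfl

lemma localMDP_policyReward_quit {s : S} (h : π.1 (Sum.inl s) = LocalAction.quit) :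
    (C.localMDP α).policyReward π (Sum.inl s) = α := by
  change C.localReward α (Sum.inl s) (π.1 (Sum.inl s)) = _
  rw [h]; rfl

lemma localAction_cases (a : LocalAction) : a = LocalAction.go ∨ a = LocalAction.quit := by
  cases a <;> simp

/-- `h0` takes care of `quit`: the mass then sits at `✓`, where it must not exceed what one more
step of the chain would give. -/
lemma killed_localMDP_le {u : S → ℝ≥0∞} {u' : S ⊕ Unit → ℝ≥0∞} (hu' : Measurable u')
    (hu : ∀ s, u' (Sum.inl s) ≤ u s) (s : S)
    (h0 : u' (Sum.inr ()) ≤ ∫⁻ s', u s' ∂(C.kernel s)) :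
    killed ((C.localMDP α).policyKernel π) (C.localMDP α).terminal u' (Sum.inl s) ≤
      killed C.kernel C.terminal u s := by
  by_cases hs : s ∈ C.terminal
  · rw [killed_of_mem ((inl_mem_localMDP_terminal α).2 hs)]
    exact bot_le
  · rw [killed_of_notMem (fun h => hs ((inl_mem_localMDP_terminal α).1 h)), killed_of_notMem hs]
    rcases localAction_cases (π.1 (Sum.inl s)) with h | h
    · rw [localMDP_policyKernel_go α π h, lintegral_map hu' measurable_inl]
      exact lintegral_mono hu
    · rw [localMDP_policyKernel_quit α π h, lintegral_dirac' _ hu']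
      exact h0

include hC in
lemma Terminating.smallTails_localMDP :
    SmallTails ((C.localMDP α).policyKernel π) (C.localMDP α).terminal
      (Sum.elim (fun s => ENNReal.ofReal (C.weight s)) 0) := by
  obtain ⟨Ψ, hm, hex, hlim, b, hle⟩ := hC.smallTails
  have hm' : ∀ c, Measurable (Sum.elim (Ψ c) (0 : Unit → ℝ≥0∞)) := fun c =>
    (hm c).sumElim measurable_const
  refine ⟨fun c => Sum.elim (Ψ c) 0, hm', fun c => ?_, ?_, b, ?_⟩
  · rintro (s | u)
    · exact (killed_localMDP_le α π (hm' c) (u := Ψ c) (fun _ => le_rfl) s (by simp)).trans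
        (hex c s)
    · rw [killed_of_mem (inr_mem_localMDP_terminal α u)]
      exact bot_le
  · rintro (s | u)
    · exact hlim s
    · simp
  · rintro c (s | u)
    · exact hle c s
    · simp

lemma measurable_policyReward {X A : Type*} [MeasurableSpace X] [MeasurableSpace A] (M : MDP X A)
    (π : Policy X A) : Measurable (M.policyReward π) :=
  M.measurable_reward.comp (measurable_id.prodMk π.2)

include hC in
lemma Terminating.absValue_localMDP_le (z : S ⊕ Unit) :
    absValue ((C.localMDP α).policyKernel π) (C.localMDP α).terminal
      ((C.localMDP α).policyReward π) z ≤
        ENNReal.ofReal |α| + 1 * Sum.elim (fun s => ENNReal.ofReal (C.weight s)) 0 z := by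
  have hm : Measurable (Sum.elim (fun s => ENNReal.ofReal |α| + absValue C.kernel C.terminal
      C.reward s) (0 : Unit → ℝ≥0∞)) :=
    (measurable_const.add (measurable_absValue C.measurableSet_terminal
      C.measurable_reward)).sumElim measurable_const
  -- The alternative is collected at most once, which accounts for the single `|α|` and for the
  -- value 0 at `✓`.
  refine (absValue_le (W := Sum.elim (fun s => ENNReal.ofReal |α| +
    absValue C.kernel C.terminal C.reward s) 0) (C.localMDP α).measurableSet_terminal
    (measurable_policyReward _ π) ?_ z).trans ?_
  · rintro (s | u) hs
    · have hs' : s ∉ C.terminal := fun h => hs ((inl_mem_localMDP_terminal α).2 h)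
      rcases localAction_cases (π.1 (Sum.inl s)) with h | h
      · rw [localMDP_policyKernel_go α π h, localMDP_policyReward_go α π h,
          lintegral_map hm measurable_inl]
        simp only [Sum.elim_inl]
        rw [absValue_of_notMem C.measurableSet_terminal C.measurable_reward hs',
          lintegral_add_left measurable_const]
        simp only [lintegral_const, measure_univ, mul_one]
        rw [add_left_comm]
      · rw [localMDP_policyKernel_quit α π h, localMDP_policyReward_quit α π h,
          lintegral_dirac' _ hm]
        simp [Real.enorm_eq_ofReal_abs]
    · exact absurd (inr_mem_localMDP_terminal α u) hs
  · rcases z with s | u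
    · simp [hC.ofReal_weight]
    · simp

include hC in
lemma Terminating.localMDP_terminates (z : S ⊕ Unit) :
    TerminatesIntegrably ((C.localMDP α).policyKernel π) (C.localMDP α).terminal
      ((C.localMDP α).policyReward π) z := by
  have hD := (C.localMDP α).measurableSet_terminal
  have hinr : ∀ t u, (killed ((C.localMDP α).policyKernel π)
      (C.localMDP α).terminal)^[t + 1] 1 (Sum.inr u) = 0 := by
    intro t u
    rw [Function.iterate_succ_apply', killed_of_mem (inr_mem_localMDP_terminal α u)]
  constructor
  · rw [ae_exists_mem_iff hD]
    rcases z with s | u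
    · have key : ∀ t s, (killed ((C.localMDP α).policyKernel π)
          (C.localMDP α).terminal)^[t] 1 (Sum.inl s) ≤ (killed C.kernel C.terminal)^[t] 1 s := by
        intro t
        induction t with
        | zero => intro s; exact le_rfl
        | succ t ih =>
          intro s
          rw [Function.iterate_succ_apply', Function.iterate_succ_apply']
          refine killed_localMDP_le α π (measurable_iterate_killed hD measurable_one t) ih s ?_
          -- At `t = 0` the point `✓` still carries the value 1, which is also the integral of 1
          -- along the chain; it carries 0 from the first step on.
          cases t with
          | zero => simp
          | succ t => rw [hinr]; exact bot_le
      exact tendsto_of_tendsto_of_tendsto_of_le_of_le tendsto_const_nhds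
        ((hC s).tendsto C.measurableSet_terminal) (fun _ => bot_le) fun t => key t s
    · rw [← tendsto_add_atTop_iff_nat 1]
      simp [hinr]
  · refine lt_of_le_of_lt (hC.absValue_localMDP_le α π z) ?_
    rcases z with s | u
    · simp
    · simp

lemma integral_localMDP_go {s : S} (h : π.1 (Sum.inl s) = LocalAction.go) {v : S → ℝ}
    (hv : Measurable v) (hvi : Integrable v (C.kernel s)) :
    Integrable (Sum.elim v 0) ((C.localMDP α).policyKernel π (Sum.inl s)) ∧
      ∫ z, Sum.elim v 0 z ∂((C.localMDP α).policyKernel π (Sum.inl s)) =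
        ∫ s', v s' ∂(C.kernel s) := by
  have hm : Measurable (Sum.elim v (0 : Unit → ℝ)) := hv.sumElim measurable_const
  rw [localMDP_policyKernel_go α π h]
  constructor
  · rw [integrable_map_measure hm.aestronglyMeasurable measurable_inl.aemeasurable]
    exact hvi
  · rw [integral_map measurable_inl.aemeasurable hm.aestronglyMeasurable]
    rfl

lemma integral_localMDP_quit {s : S} (h : π.1 (Sum.inl s) = LocalAction.quit) {v : S → ℝ}
    (hv : Measurable v) :
    Integrable (Sum.elim v 0) ((C.localMDP α).policyKernel π (Sum.inl s)) ∧
      ∫ z, Sum.elim v 0 z ∂((C.localMDP α).policyKernel π (Sum.inl s)) = 0 := by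
  have hm : Measurable (Sum.elim v (0 : Unit → ℝ)) := hv.sumElim measurable_const
  rw [localMDP_policyKernel_quit α π h]
  constructor
  · exact integrable_dirac' hm.stronglyMeasurable (by simp)
  · rw [integral_dirac' _ _ hm.stronglyMeasurable]
    rfl

include hC in
lemma Terminating.enorm_stopValue_le (z : S ⊕ Unit) :
    ‖Sum.elim (C.stopValue α) 0 z‖ₑ ≤
      ENNReal.ofReal |α| + 1 * Sum.elim (fun s => ENNReal.ofReal (C.weight s)) 0 z := by
  rcases z with s | u
  · simp only [Sum.elim_inl, one_mul]
    rw [Real.enorm_eq_ofReal_abs, ← ENNReal.ofReal_add (abs_nonneg _) (weight_nonneg s)]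
    refine ENNReal.ofReal_le_ofReal ?_
    simpa using hC.abs_stopValue_le α s
  · simp

lemma stopValue_elim_of_mem (z : S ⊕ Unit) (hz : z ∈ (C.localMDP α).terminal) :
    Sum.elim (C.stopValue α) 0 z = 0 := by
  rcases z with s | u
  · exact stopValue_of_mem α ((inl_mem_localMDP_terminal α).1 hz)
  · rfl

include hC in
-- The maximum in the Bellman equation dominates both actions, so `stopValue` is superharmonic under
-- every policy. The greedy policy below turns both inequalities around.
lemma Terminating.value_le_stopValue (s : S) :
    (C.localMDP α).value π (Sum.inl s) ≤ C.stopValue α s := by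
  refine totalValue_le (C.localMDP α).measurableSet_terminal (measurable_policyReward _ π)
    (hC.localMDP_terminates α π) (hC.smallTails_localMDP α π) (ofReal_ne_top (r := |α|))
    one_ne_top (hC.absValue_localMDP_le α π) (v := Sum.elim (C.stopValue α) 0)
    (hC.enorm_stopValue_le α) (stopValue_elim_of_mem α) ?_ (Sum.inl s)
  rintro (s | u) hs
  · have hs' : s ∉ C.terminal := fun h => hs ((inl_mem_localMDP_terminal α).2 h)
    rcases localAction_cases (π.1 (Sum.inl s)) with h | h
    · obtain ⟨h1, h2⟩ := integral_localMDP_go α π h (measurable_stopValue α)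
        (hC.integrable_stopValue α s)
      refine ⟨h1, ?_⟩
      rw [h2, localMDP_policyReward_go α π h, Sum.elim_inl, hC.stopValue_of_notMem α hs']
      exact le_max_right _ _
    · obtain ⟨h1, h2⟩ := integral_localMDP_quit α π h (C := C) (measurable_stopValue (C := C) α)
      refine ⟨h1, ?_⟩
      rw [h2, localMDP_policyReward_quit α π h, Sum.elim_inl, hC.stopValue_of_notMem α hs',
        add_zero]
      exact le_max_left _ _
  · exact absurd (inr_mem_localMDP_terminal α u) hs

variable (C) in
open Classical in
/-- The policy of the local MDP that continues exactly when this is optimal. -/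
def greedy : Policy (S ⊕ Unit) LocalAction :=
  ⟨Sum.elim (fun s => if α ≤ C.reward s + ∫ s', C.stopValue α s' ∂(C.kernel s) then
      LocalAction.go else LocalAction.quit) (fun _ => LocalAction.quit), by
    refine Measurable.sumElim (Measurable.ite ?_ measurable_const measurable_const)
      measurable_const
    exact measurableSet_le measurable_const (C.measurable_reward.add
      (measurable_stopValue α).stronglyMeasurable.integral_kernel.measurable)⟩

include hC in
lemma Terminating.stopValue_le_value_greedy (s : S) :
    C.stopValue α s ≤ (C.localMDP α).value (C.greedy α) (Sum.inl s) := by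
  refine le_totalValue (C.localMDP α).measurableSet_terminal (measurable_policyReward _ _)
    (hC.localMDP_terminates α _) (hC.smallTails_localMDP α _) (ofReal_ne_top (r := |α|))
    one_ne_top (hC.absValue_localMDP_le α _) (v := Sum.elim (C.stopValue α) 0)
    (hC.enorm_stopValue_le α) (stopValue_elim_of_mem α) ?_ (Sum.inl s)
  rintro (s | u) hs
  · have hs' : s ∉ C.terminal := fun h => hs ((inl_mem_localMDP_terminal α).2 h)
    by_cases hα : α ≤ C.reward s + ∫ s', C.stopValue α s' ∂(C.kernel s)
    · have h : (C.greedy α).1 (Sum.inl s) = LocalAction.go := by simp [greedy, hα]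
      obtain ⟨h1, h2⟩ := integral_localMDP_go α _ h (measurable_stopValue α)
        (hC.integrable_stopValue α s)
      refine ⟨h1, ?_⟩
      rw [h2, localMDP_policyReward_go α _ h, Sum.elim_inl, hC.stopValue_of_notMem α hs']
      exact max_le hα le_rfl
    · have h : (C.greedy α).1 (Sum.inl s) = LocalAction.quit := by simp [greedy, hα]
      obtain ⟨h1, h2⟩ := integral_localMDP_quit α _ h (C := C) (measurable_stopValue (C := C) α)
      refine ⟨h1, ?_⟩
      rw [h2, localMDP_policyReward_quit α _ h, Sum.elim_inl, hC.stopValue_of_notMem α hs',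
        add_zero]
      exact max_le le_rfl (not_le.1 hα).le
  · exact absurd (inr_mem_localMDP_terminal α u) hs

include hC in
theorem Terminating.localValue_eq_stopValue (s : S) : C.localValue s α = C.stopValue α s := by
  have : Nonempty (Policy (S ⊕ Unit) LocalAction) := ⟨C.greedy α⟩
  refine le_antisymm (ciSup_le fun π => hC.value_le_stopValue α π s) ?_
  exact (hC.stopValue_le_value_greedy α s).trans (le_ciSup (f := fun π =>
    (C.localMDP α).value π (Sum.inl s)) ⟨C.stopValue α s, by
      rintro _ ⟨π, rfl⟩; exact hC.value_le_stopValue α π s⟩ _)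

end LocalMDP

end RewardChain

/-! ### Dependence of the local value on the alternative -/

namespace RewardChain

open Filter Topology ENNReal

variable {S : Type*} [MeasurableSpace S] {C : RewardChain S} (hC : C.Terminating)

variable (C) in
/-- The value of continuing in the local MDP. -/
def contValue (α : ℝ) (s : S) : ℝ := C.reward s + ∫ s', C.stopValue α s' ∂(C.kernel s)

lemma measurable_contValue (α : ℝ) : Measurable (C.contValue α) :=
  C.measurable_reward.add (measurable_stopValue α).stronglyMeasurable.integral_kernel.measurable

include hC in
lemma Terminating.stopValue_eq_max (α : ℝ) {s : S} (hs : s ∉ C.terminal) :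
    C.stopValue α s = max α (C.contValue α s) := hC.stopValue_of_notMem α hs

variable (C) in
/-- The probability of visiting `Z` before termination. -/
def hitProb (Z : Set S) (s : S) : ℝ :=
  (pathLaw C.kernel s).real {x | ∃ t ∈ timesBefore C.terminal x, x t ∈ Z}

lemma measurableSet_hit {Z : Set S} (hZ : MeasurableSet Z) :
    MeasurableSet {x : ℕ → S | ∃ t ∈ timesBefore C.terminal x, x t ∈ Z} := by
  have : {x : ℕ → S | ∃ t ∈ timesBefore C.terminal x, x t ∈ Z} =
      ⋃ t, {x | t ∈ timesBefore C.terminal x} ∩ (fun x : ℕ → S => x t) ⁻¹' Z := by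
    ext x; simp
  rw [this]
  exact MeasurableSet.iUnion fun t =>
    (measurableSet_mem_timesBefore C.measurableSet_terminal t).inter (measurable_pi_apply t hZ)

lemma hit_consPath {Z : Set S} {s : S} {x : ℕ → S} :
    (∃ t ∈ timesBefore C.terminal (consPath s x), consPath s x t ∈ Z) ↔
      s ∉ C.terminal ∧ (s ∈ Z ∨ ∃ t ∈ timesBefore C.terminal x, x t ∈ Z) := by
  constructor
  · rintro ⟨t, ht, hx⟩
    cases t with
    | zero => exact ⟨mem_timesBefore_consPath_zero.1 ht, Or.inl hx⟩
    | succ t =>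
      have h := mem_timesBefore_consPath_succ.1 ht
      exact ⟨h.1, Or.inr ⟨t, h.2, hx⟩⟩
  · rintro ⟨hs, h | ⟨t, ht, hx⟩⟩
    · exact ⟨0, mem_timesBefore_consPath_zero.2 hs, h⟩
    · exact ⟨t + 1, mem_timesBefore_consPath_succ.2 ⟨hs, ht⟩, hx⟩

lemma pathLaw_hit_eq {Z : Set S} (hZ : MeasurableSet Z) (s : S) :
    pathLaw C.kernel s {x | ∃ t ∈ timesBefore C.terminal x, x t ∈ Z} =
      ∫⁻ s', pathLaw C.kernel s' {x | s ∉ C.terminal ∧ (s ∈ Z ∨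
        ∃ t ∈ timesBefore C.terminal x, x t ∈ Z)} ∂(C.kernel s) := by
  have hm := measurableSet_hit (C := C) hZ
  rw [← lintegral_indicator_one hm, lintegral_pathLaw C.kernel s (measurable_one.indicator hm)]
  refine lintegral_congr fun s' => ?_
  have hm' : MeasurableSet {x : ℕ → S | s ∉ C.terminal ∧ (s ∈ Z ∨
        ∃ t ∈ timesBefore C.terminal x, x t ∈ Z)} := by
    have := measurable_consPath s hm
    convert! this using 1
    ext x
    exact hit_consPath.symm
  rw [← lintegral_indicator_one hm']
  refine lintegral_congr fun x => ?_
  refine Set.indicator_eq_indicator ?_ rfl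
  exact hit_consPath

lemma hitProb_of_mem {Z : Set S} (hZ : MeasurableSet Z) {s : S} (hs : s ∈ C.terminal) :
    C.hitProb Z s = 0 := by
  simp [hitProb, Measure.real, pathLaw_hit_eq hZ s, hs]

lemma hitProb_of_mem_set {Z : Set S} (hZ : MeasurableSet Z) {s : S} (hs : s ∉ C.terminal)
    (hsZ : s ∈ Z) : C.hitProb Z s = 1 := by
  simp [hitProb, Measure.real, pathLaw_hit_eq hZ s, hs, hsZ]

lemma hitProb_nonneg (Z : Set S) (s : S) : 0 ≤ C.hitProb Z s := measureReal_nonneg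

lemma hitProb_le_one (Z : Set S) (s : S) : C.hitProb Z s ≤ 1 := measureReal_le_one

lemma measurable_hitProb {Z : Set S} (hZ : MeasurableSet Z) : Measurable (C.hitProb Z) :=
  ((Kernel.measurable_coe (pathKernel C.kernel) (measurableSet_hit hZ))).ennreal_toReal

lemma integrable_hitProb {Z : Set S} (hZ : MeasurableSet Z) (s : S) :
    Integrable (C.hitProb Z) (C.kernel s) :=
  (integrable_const (1 : ℝ)).mono' (measurable_hitProb hZ).aestronglyMeasurable
    (ae_of_all _ fun s' => by
      rw [Real.norm_of_nonneg (hitProb_nonneg Z s')]; exact hitProb_le_one Z s')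

lemma hitProb_of_notMem {Z : Set S} (hZ : MeasurableSet Z) {s : S} (hs : s ∉ C.terminal)
    (hsZ : s ∉ Z) : C.hitProb Z s = ∫ s', C.hitProb Z s' ∂(C.kernel s) := by
  rw [hitProb, Measure.real, pathLaw_hit_eq hZ s]
  simp only [hs, hsZ, not_false_eq_true, true_and, false_or]
  rw [← integral_toReal]
  · rfl
  · exact (Kernel.measurable_coe (pathKernel C.kernel) (measurableSet_hit hZ)).aemeasurable
  · exact ae_of_all _ fun s' => measure_lt_top _ _

variable (C) in
/-- The states in which stopping is optimal. -/
def stopSet (α : ℝ) : Set S := {s | C.contValue α s ≤ α}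

lemma measurableSet_stopSet (α : ℝ) : MeasurableSet (C.stopSet α) :=
  measurableSet_le (measurable_contValue α) measurable_const

include hC in
lemma Terminating.le_stopValue (α : ℝ) {s : S} (hs : s ∉ C.terminal) : α ≤ C.stopValue α s := by
  rw [hC.stopValue_eq_max α hs]; exact le_max_left _ _

include hC in
lemma Terminating.contValue_le_stopValue (α : ℝ) {s : S} (hs : s ∉ C.terminal) :
    C.contValue α s ≤ C.stopValue α s := by
  rw [hC.stopValue_eq_max α hs]; exact le_max_right _ _

include hC in
lemma Terminating.stopValue_of_mem_stopSet {α : ℝ} {s : S} (hs : s ∉ C.terminal)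
    (h : s ∈ C.stopSet α) : C.stopValue α s = α := by
  rw [hC.stopValue_eq_max α hs]; exact max_eq_left h

include hC in
lemma Terminating.stopValue_of_notMem_stopSet {α : ℝ} {s : S} (hs : s ∉ C.terminal)
    (h : s ∉ C.stopSet α) : C.stopValue α s = C.contValue α s := by
  rw [hC.stopValue_eq_max α hs]; exact max_eq_right (not_le.1 h).le

include hC in
-- Use the stopping rule that is optimal for `α` with the alternative `β`: the payoff grows by `β -
-- α` on exactly those trajectories that stop. Formally, the difference is nonnegative on the
-- stopping set and superharmonic off it.
lemma Terminating.mul_hitProb_le {α β : ℝ} (h : α ≤ β) (s : S) :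
    (β - α) * C.hitProb (C.stopSet α) s ≤ C.stopValue β s - C.stopValue α s := by
  have hZ := measurableSet_stopSet (C := C) α
  rw [← sub_nonneg]
  refine hC.nonneg (d := fun s => C.stopValue β s - C.stopValue α s -
    (β - α) * C.hitProb (C.stopSet α) s) (a := |β| + |α| + (β - α)) (b := 2) (by
      have := sub_nonneg.2 h; positivity) (by norm_num) (fun s => ?_) (fun s hs => ?_)
      (fun s hs => ?_) s
  · have h1 := hC.abs_stopValue_le α s
    have h2 := hC.abs_stopValue_le β s
    have h3 : |(β - α) * C.hitProb (C.stopSet α) s| ≤ β - α := by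
      rw [abs_of_nonneg (mul_nonneg (sub_nonneg.2 h) (hitProb_nonneg _ s))]
      exact mul_le_of_le_one_right (sub_nonneg.2 h) (hitProb_le_one _ s)
    have h4 := abs_sub (C.stopValue β s - C.stopValue α s) ((β - α) * C.hitProb (C.stopSet α) s)
    have h5 := abs_sub (C.stopValue β s) (C.stopValue α s)
    linarith
  · simp [stopValue_of_mem _ hs, hitProb_of_mem hZ hs]
  · by_cases hsZ : s ∈ C.stopSet α
    · left
      rw [hitProb_of_mem_set hZ hs hsZ, hC.stopValue_of_mem_stopSet hs hsZ]
      linarith [hC.le_stopValue β hs]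
    · right
      have h1 := hC.integrable_stopValue α s
      have h2 := hC.integrable_stopValue β s
      have h3 := (integrable_hitProb (C := C) hZ s).const_mul (β - α)
      have h21 : Integrable (fun s' => C.stopValue β s' - C.stopValue α s') (C.kernel s) :=
        h2.sub h1
      refine ⟨h21.sub h3, ?_⟩
      rw [integral_sub h21 h3, integral_sub h2 h1, integral_const_mul,
        ← hitProb_of_notMem hZ hs hsZ, hC.stopValue_of_notMem_stopSet hs hsZ]
      have h4 := hC.contValue_le_stopValue β hs
      simp only [contValue] at h4 ⊢
      linarith

include hC in
-- The mirror image: the rule that is optimal for `β`, used with `α`, loses `β - α` only where it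
-- stops.
lemma Terminating.le_mul_hitProb {α β : ℝ} (h : α ≤ β) (s : S) :
    C.stopValue β s - C.stopValue α s ≤ (β - α) * C.hitProb (C.stopSet β) s := by
  have hZ := measurableSet_stopSet (C := C) β
  rw [← sub_nonneg]
  refine hC.nonneg (d := fun s => (β - α) * C.hitProb (C.stopSet β) s -
    (C.stopValue β s - C.stopValue α s)) (a := |β| + |α| + (β - α)) (b := 2) (by
      have := sub_nonneg.2 h; positivity) (by norm_num) (fun s => ?_) (fun s hs => ?_)
      (fun s hs => ?_) s
  · have h1 := hC.abs_stopValue_le α s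
    have h2 := hC.abs_stopValue_le β s
    have h3 : |(β - α) * C.hitProb (C.stopSet β) s| ≤ β - α := by
      rw [abs_of_nonneg (mul_nonneg (sub_nonneg.2 h) (hitProb_nonneg _ s))]
      exact mul_le_of_le_one_right (sub_nonneg.2 h) (hitProb_le_one _ s)
    have h4 := abs_sub ((β - α) * C.hitProb (C.stopSet β) s) (C.stopValue β s - C.stopValue α s)
    have h5 := abs_sub (C.stopValue β s) (C.stopValue α s)
    linarith
  · simp [stopValue_of_mem _ hs, hitProb_of_mem hZ hs]
  · by_cases hsZ : s ∈ C.stopSet β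
    · left
      rw [hitProb_of_mem_set hZ hs hsZ, hC.stopValue_of_mem_stopSet hs hsZ]
      linarith [hC.le_stopValue α hs]
    · right
      have h1 := hC.integrable_stopValue α s
      have h2 := hC.integrable_stopValue β s
      have h3 := (integrable_hitProb (C := C) hZ s).const_mul (β - α)
      have h21 : Integrable (fun s' => C.stopValue β s' - C.stopValue α s') (C.kernel s) :=
        h2.sub h1
      refine ⟨h3.sub h21, ?_⟩
      rw [integral_sub h3 h21, integral_sub h2 h1, integral_const_mul,
        ← hitProb_of_notMem hZ hs hsZ, hC.stopValue_of_notMem_stopSet hs hsZ]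
      have h4 := hC.contValue_le_stopValue α hs
      simp only [contValue] at h4 ⊢
      linarith

include hC in
lemma Terminating.stopValue_mono {α β : ℝ} (h : α ≤ β) (s : S) :
    C.stopValue α s ≤ C.stopValue β s := by
  have h1 := hC.mul_hitProb_le h s
  have h2 := mul_nonneg (sub_nonneg.2 h) (hitProb_nonneg (C := C) (C.stopSet α) s)
  linarith

include hC in
lemma Terminating.stopValue_sub_le {α β : ℝ} (h : α ≤ β) (s : S) :
    C.stopValue β s - C.stopValue α s ≤ β - α :=
  (hC.le_mul_hitProb h s).trans
    (mul_le_of_le_one_right (sub_nonneg.2 h) (hitProb_le_one _ s))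

include hC in
lemma Terminating.contValue_mono {α β : ℝ} (h : α ≤ β) (s : S) :
    C.contValue α s ≤ C.contValue β s :=
  add_le_add le_rfl (integral_mono (hC.integrable_stopValue α s) (hC.integrable_stopValue β s)
    fun s' => hC.stopValue_mono h s')

include hC in
lemma Terminating.contValue_sub_le {α β : ℝ} (h : α ≤ β) (s : S) :
    C.contValue β s - C.contValue α s ≤ β - α := by
  have h1 := hC.integrable_stopValue α s
  have h2 := hC.integrable_stopValue β s
  have h3 : ∫ s', C.stopValue β s' - C.stopValue α s' ∂(C.kernel s) ≤
      ∫ _, β - α ∂(C.kernel s) :=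
    integral_mono (h2.sub h1) (integrable_const _) fun s' => hC.stopValue_sub_le h s'
  rw [integral_sub h2 h1] at h3
  simp only [integral_const, probReal_univ, one_smul] at h3
  simp only [contValue]
  linarith

include hC in
-- Each policy has a payoff affine in the alternative, and a supremum of affine functions is convex.
-- The comparison principle gives this without policies: the defect is nonnegative where stopping is
-- optimal for `γ`, and superharmonic elsewhere.
lemma Terminating.stopValue_convex {α β a b : ℝ} (ha : 0 ≤ a) (hb : 0 ≤ b) (hab : a + b = 1)
    (s : S) : C.stopValue (a * α + b * β) s ≤ a * C.stopValue α s + b * C.stopValue β s := by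
  set γ := a * α + b * β with hγ
  rw [← sub_nonneg]
  refine hC.nonneg (d := fun s => a * C.stopValue α s + b * C.stopValue β s - C.stopValue γ s)
    (a := a * |α| + b * |β| + |γ|) (b := 2) (by positivity) (by norm_num) (fun s => ?_)
    (fun s hs => ?_) (fun s hs => ?_) s
  · have h1 := hC.abs_stopValue_le α s
    have h2 := hC.abs_stopValue_le β s
    have h3 := hC.abs_stopValue_le γ s
    have h4 := abs_sub (a * C.stopValue α s + b * C.stopValue β s) (C.stopValue γ s)
    have h5 := abs_add_le (a * C.stopValue α s) (b * C.stopValue β s)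
    rw [abs_mul, abs_mul, abs_of_nonneg ha, abs_of_nonneg hb] at h5
    have h6 := mul_le_mul_of_nonneg_left h1 ha
    have h7 := mul_le_mul_of_nonneg_left h2 hb
    have h8 : a * C.weight s + b * C.weight s = C.weight s := by rw [← add_mul, hab, one_mul]
    linarith
  · simp [stopValue_of_mem _ hs]
  · by_cases hsZ : s ∈ C.stopSet γ
    · left
      rw [hC.stopValue_of_mem_stopSet hs hsZ]
      have h1 := mul_le_mul_of_nonneg_left (hC.le_stopValue α hs) ha
      have h2 := mul_le_mul_of_nonneg_left (hC.le_stopValue β hs) hb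
      linarith
    · right
      have h1 := (hC.integrable_stopValue α s).const_mul a
      have h2 := (hC.integrable_stopValue β s).const_mul b
      have h3 := hC.integrable_stopValue γ s
      refine ⟨(h1.add h2).sub h3, ?_⟩
      have h4 := mul_le_mul_of_nonneg_left (hC.contValue_le_stopValue α hs) ha
      have h5 := mul_le_mul_of_nonneg_left (hC.contValue_le_stopValue β hs) hb
      have h12 : ∫ s', (a * C.stopValue α s' + b * C.stopValue β s') - C.stopValue γ s'
          ∂(C.kernel s) = _ := integral_sub (h1.add h2) h3
      rw [h12, integral_add h1 h2, integral_const_mul, integral_const_mul, hC.stopValue_of_notMem_stopSet hs hsZ]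
      simp only [contValue] at h4 h5 ⊢
      have h6 : a * C.reward s + b * C.reward s = C.reward s := by rw [← add_mul, hab, one_mul]
      linarith

include hC in
lemma Terminating.contValue_convex {α β a b : ℝ} (ha : 0 ≤ a) (hb : 0 ≤ b) (hab : a + b = 1)
    (s : S) : C.contValue (a * α + b * β) s ≤ a * C.contValue α s + b * C.contValue β s := by
  have h1 := (hC.integrable_stopValue α s).const_mul a
  have h2 := (hC.integrable_stopValue β s).const_mul b
  have h3 := integral_mono (hC.integrable_stopValue (a * α + b * β) s) (h1.add h2)
    fun s' => hC.stopValue_convex ha hb hab s'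
  simp only [Pi.add_apply] at h3
  rw [integral_add h1 h2, integral_const_mul, integral_const_mul] at h3
  simp only [contValue]
  have h6 : a * C.reward s + b * C.reward s = C.reward s := by rw [← add_mul, hab, one_mul]
  linarith

include hC in
-- Never stopping loses at most the weight. The bound is uniform in `α`, which is what the limit `α
-- → -∞` and the integrability of the surrogate value require.
lemma Terminating.neg_weight_le_stopValue (α : ℝ) (s : S) : -C.weight s ≤ C.stopValue α s := by
  have := hC.nonneg (d := fun s => C.stopValue α s + C.weight s) (a := |α|) (b := 2)
    (abs_nonneg _) (by norm_num) (fun s => ?_) (fun s hs => ?_) (fun s hs => Or.inr ?_) s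
  · linarith
  · have h1 := hC.abs_stopValue_le α s
    have h2 := abs_add_le (C.stopValue α s) (C.weight s)
    rw [abs_of_nonneg (weight_nonneg (C := C) s)] at h2
    linarith
  · simp [stopValue_of_mem _ hs, weight_of_mem hs]
  · have h1 := hC.integrable_stopValue α s
    have h2 := hC.integrable_weight s
    refine ⟨h1.add h2, ?_⟩
    rw [integral_add h1 h2, hC.weight_eq hs]
    have h3 := hC.contValue_le_stopValue α hs
    have h4 := neg_abs_le (C.reward s)
    simp only [contValue] at h3
    linarith

include hC in
lemma Terminating.neg_weight_le_contValue (α : ℝ) {s : S} (hs : s ∉ C.terminal) :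
    -C.weight s ≤ C.contValue α s := by
  have h1 := integral_mono (hC.integrable_weight s).neg (hC.integrable_stopValue α s)
    fun s' => hC.neg_weight_le_stopValue α s'
  simp only [Pi.neg_apply] at h1
  rw [integral_neg] at h1
  rw [hC.weight_eq hs, contValue]
  have h4 := neg_abs_le (C.reward s)
  linarith

/-! ### Large alternatives -/

variable (C) in
/-- The gain of the optimal policy over stopping at once. -/
def gain (m : ℕ) (s : S) : ℝ := C.terminalᶜ.indicator (fun s => C.stopValue m s - m) s

lemma gain_of_mem (m : ℕ) {s : S} (hs : s ∈ C.terminal) : C.gain m s = 0 := by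
  simp [gain, hs]

lemma gain_of_notMem (m : ℕ) {s : S} (hs : s ∉ C.terminal) :
    C.gain m s = C.stopValue m s - m := by
  simp [gain, hs]

lemma measurable_gain (m : ℕ) : Measurable (C.gain m) :=
  ((measurable_stopValue _).sub_const _).indicator C.measurableSet_terminal.compl

include hC in
lemma Terminating.gain_nonneg (m : ℕ) (s : S) : 0 ≤ C.gain m s := by
  by_cases hs : s ∈ C.terminal
  · rw [gain_of_mem m hs]
  · rw [gain_of_notMem m hs]
    linarith [hC.le_stopValue m hs]

include hC in
lemma Terminating.gain_antitone : Antitone C.gain := by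
  intro m m' h s
  by_cases hs : s ∈ C.terminal
  · rw [gain_of_mem m hs, gain_of_mem m' hs]
  · rw [gain_of_notMem m hs, gain_of_notMem m' hs]
    have := hC.stopValue_sub_le (α := m) (β := m') (by exact_mod_cast h) s
    linarith

include hC in
lemma Terminating.gain_le_weight (m : ℕ) (s : S) : C.gain m s ≤ C.weight s := by
  refine (hC.gain_antitone (Nat.zero_le m) s).trans ?_
  by_cases hs : s ∈ C.terminal
  · rw [gain_of_mem _ hs]; exact weight_nonneg s
  · rw [gain_of_notMem _ hs]
    have := (le_abs_self _).trans (hC.abs_stopValue_le ((0 : ℕ) : ℝ) s)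
    simp only [Nat.cast_zero, abs_zero, one_mul, zero_add, sub_zero] at this ⊢
    exact this

include hC in
lemma Terminating.integrable_gain (m : ℕ) (s : S) : Integrable (C.gain m) (C.kernel s) :=
  (hC.integrable_weight s).mono' (measurable_gain m).aestronglyMeasurable
    (ae_of_all _ fun s' => by
      rw [Real.norm_of_nonneg (hC.gain_nonneg m s')]; exact hC.gain_le_weight m s')

include hC in
-- Stepping into a terminal state forfeits the alternative, which costs `m` times the probability of
-- that step; elsewhere only the gain remains.
lemma Terminating.contValue_sub_eq (m : ℕ) (s : S) :
    C.contValue m s - m = C.reward s - m * (C.kernel s).real C.terminal +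
      ∫ s', C.gain m s' ∂(C.kernel s) := by
  have h1 : ∀ s', C.stopValue m s' - m =
      C.gain m s' - C.terminal.indicator (fun _ => (m : ℝ)) s' := by
    intro s'
    by_cases hs : s' ∈ C.terminal
    · simp [gain_of_mem m hs, hs, stopValue_of_mem _ hs]
    · simp [gain_of_notMem m hs, hs]
  have h2 : ∫ s', (C.stopValue m s' - m) ∂(C.kernel s) =
      ∫ s', C.gain m s' ∂(C.kernel s) - m * (C.kernel s).real C.terminal := by
    simp only [h1]
    rw [integral_sub (hC.integrable_gain m s)
      ((integrable_const _).indicator C.measurableSet_terminal),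
      integral_indicator_const _ C.measurableSet_terminal, smul_eq_mul, mul_comm]
  rw [integral_sub (hC.integrable_stopValue _ s) (integrable_const _)] at h2
  simp only [integral_const, probReal_univ, one_smul] at h2
  simp only [contValue]
  linarith

/-- Here the exclusion of free states enters: either the reward is negative, or termination has
positive probability and a large forfeited alternative outweighs the reward. -/
lemma exists_forall_reward_lt {s : S} (hf : ¬ C.IsFree s) :
    ∃ ε > 0, ∃ m₀ : ℕ, ∀ m ≥ m₀, C.reward s - m * (C.kernel s).real C.terminal ≤ -ε := by
  by_cases hr : C.reward s < 0
  · refine ⟨-C.reward s, by linarith, 0, fun m _ => ?_⟩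
    have : 0 ≤ m * (C.kernel s).real C.terminal := by positivity
    linarith
  · have hp : C.kernel s C.terminal ≠ 0 := fun h => hf ⟨not_lt.1 hr, h⟩
    have hp' : 0 < (C.kernel s).real C.terminal :=
      ENNReal.toReal_pos hp (measure_ne_top _ _)
    obtain ⟨m₀, hm₀⟩ := exists_nat_gt ((C.reward s + 1) / (C.kernel s).real C.terminal)
    refine ⟨1, one_pos, m₀, fun m hm => ?_⟩
    rw [div_lt_iff₀ hp'] at hm₀
    have : (m₀ : ℝ) * (C.kernel s).real C.terminal ≤ m * (C.kernel s).real C.terminal :=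
      mul_le_mul_of_nonneg_right (by exact_mod_cast hm) hp'.le
    linarith

include hC in
lemma Terminating.ofReal_integral_gain (m : ℕ) (s : S) :
    ENNReal.ofReal (∫ s', C.gain m s' ∂(C.kernel s)) =
      ∫⁻ s', ENNReal.ofReal (C.gain m s') ∂(C.kernel s) :=
  ofReal_integral_eq_lintegral_ofReal (hC.integrable_gain m s)
    (ae_of_all _ fun s' => hC.gain_nonneg m s')

include hC in
lemma Terminating.lintegral_iInf_gain (s : S) :
    ∫⁻ s', ⨅ m, ENNReal.ofReal (C.gain m s') ∂(C.kernel s) =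
      ⨅ m, ∫⁻ s', ENNReal.ofReal (C.gain m s') ∂(C.kernel s) := by
  refine lintegral_iInf (fun m => (measurable_gain m).ennreal_ofReal)
    (fun m m' h s' => ENNReal.ofReal_le_ofReal (hC.gain_antitone h s')) ?_
  rw [← hC.ofReal_integral_gain]
  exact ofReal_ne_top

include hC in
-- For large `m` the net immediate reward is negative, so the gain is at most its average over the
-- next state. How large depends on `s`, so subharmonicity is claimed only for the limit in `m`. The
-- limit is dominated by the weight, and the comparison principle makes it vanish.
lemma Terminating.iInf_gain_eq_zero (hfree : ∀ s, ¬ C.IsFree s) (s : S) :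
    ⨅ m, ENNReal.ofReal (C.gain m s) = 0 := by
  refine hC.smallTails.eq_zero (u := fun s => ⨅ m, ENNReal.ofReal (C.gain m s)) (a := 0) (b := 1)
    C.measurableSet_terminal zero_ne_top one_ne_top (fun s => ?_) (fun s => ?_)
    ((hC s).tendsto C.measurableSet_terminal)
  · rw [zero_add, one_mul]
    exact (iInf_le _ 0).trans (ENNReal.ofReal_le_ofReal (hC.gain_le_weight 0 s))
  · by_cases hs : s ∈ C.terminal
    · simp [gain_of_mem _ hs]
    · rw [killed_of_notMem hs, hC.lintegral_iInf_gain]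
      obtain ⟨ε, hε, m₀, hm₀⟩ := exists_forall_reward_lt (hfree s)
      refine le_iInf fun m => ?_
      set k := max m m₀ with hk
      refine (iInf_le _ k).trans (le_trans ?_ (lintegral_mono fun s' =>
        ENNReal.ofReal_le_ofReal (hC.gain_antitone (le_max_left m m₀) s')))
      rw [← hC.ofReal_integral_gain]
      refine ENNReal.ofReal_le_ofReal ?_
      rw [gain_of_notMem _ hs, hC.stopValue_eq_max _ hs]
      have h1 := hC.contValue_sub_eq k s
      have h2 := hm₀ k (le_max_right _ _)
      have h3 : 0 ≤ ∫ s', C.gain k s' ∂(C.kernel s) :=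
        integral_nonneg fun s' => hC.gain_nonneg k s'
      rw [sub_le_iff_le_add]
      exact max_le (by linarith) (by linarith)

include hC in
lemma Terminating.exists_contValue_lt (hfree : ∀ s, ¬ C.IsFree s) (s : S) :
    ∃ m : ℕ, C.contValue m s < m := by
  obtain ⟨ε, hε, m₀, hm₀⟩ := exists_forall_reward_lt (hfree s)
  have h0 := hC.lintegral_iInf_gain s
  simp only [hC.iInf_gain_eq_zero hfree, lintegral_zero] at h0
  have h1 : ⨅ m, ∫⁻ s', ENNReal.ofReal (C.gain m s') ∂(C.kernel s) < ENNReal.ofReal ε := by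
    rw [← h0]; simpa using hε
  obtain ⟨m, hm⟩ := iInf_lt_iff.1 h1
  rw [← hC.ofReal_integral_gain, ENNReal.ofReal_lt_ofReal_iff hε] at hm
  refine ⟨max m m₀, ?_⟩
  have h2 := hC.contValue_sub_eq (max m m₀) s
  have h3 := hm₀ (max m m₀) (le_max_right _ _)
  have h4 : ∫ s', C.gain (max m m₀) s' ∂(C.kernel s) ≤ ∫ s', C.gain m s' ∂(C.kernel s) :=
    integral_mono (hC.integrable_gain _ s) (hC.integrable_gain _ s)
      (hC.gain_antitone (le_max_left m m₀))
  linarith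

/-! ### The Gittins index -/

include hC in
lemma Terminating.continuous_contValue (s : S) : Continuous fun α => C.contValue α s := by
  refine (LipschitzWith.of_dist_le_mul (K := 1) fun α β => ?_).continuous
  rw [NNReal.coe_one, one_mul, Real.dist_eq, Real.dist_eq]
  rcases le_total α β with h | h
  · rw [abs_sub_comm, abs_sub_comm α β, abs_of_nonneg (sub_nonneg.2 (hC.contValue_mono h s)),
      abs_of_nonneg (sub_nonneg.2 h)]
    exact hC.contValue_sub_le h s
  · rw [abs_of_nonneg (sub_nonneg.2 (hC.contValue_mono h s)), abs_of_nonneg (sub_nonneg.2 h)]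
    exact hC.contValue_sub_le h s

include hC in
-- Intermediate value theorem: continuing is at least as good as the alternative `-C.weight s`, and
-- worse than a sufficiently large one.
lemma Terminating.exists_contValue_eq (hfree : ∀ s, ¬ C.IsFree s) {s : S} (hs : s ∉ C.terminal) :
    ∃ g, C.contValue g s = g := by
  obtain ⟨m, hm⟩ := hC.exists_contValue_lt hfree s
  have hcont : Continuous fun α => C.contValue α s - α :=
    (hC.continuous_contValue s).sub continuous_id
  have h1 : 0 ≤ C.contValue (-C.weight s) s - (-C.weight s) :=
    sub_nonneg.2 (hC.neg_weight_le_contValue _ hs)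
  obtain ⟨g, hg⟩ := mem_range_of_exists_le_of_exists_ge hcont
    ⟨(m : ℝ), (sub_neg.2 hm).le⟩ ⟨-C.weight s, h1⟩
  exact ⟨g, sub_eq_zero.1 hg⟩

include hC in
-- Continuation value minus alternative is convex, zero at `g` and negative at some `m`, hence
-- negative between them. Beyond `m` it does not increase, by the Lipschitz bound.
lemma Terminating.contValue_lt (hfree : ∀ s, ¬ C.IsFree s) {s : S} {g α : ℝ}
    (hg : C.contValue g s = g) (hα : g < α) : C.contValue α s < α := by
  obtain ⟨m, hm⟩ := hC.exists_contValue_lt hfree s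
  rcases le_total (m : ℝ) α with h | h
  · linarith [hC.contValue_sub_le h s]
  · have hmg : 0 < m - g := by linarith
    have h1 := hC.contValue_convex (α := g) (β := m) (a := (m - α) / (m - g))
      (b := (α - g) / (m - g)) (div_nonneg (by linarith) hmg.le)
      (div_nonneg (by linarith) hmg.le) (by field_simp; ring) s
    have h2 : (m - α) / (m - g) * g + (α - g) / (m - g) * m = α := by field_simp; ring
    rw [h2, hg] at h1
    have h3 : (α - g) / (m - g) * C.contValue m s < (α - g) / (m - g) * m :=
      mul_lt_mul_of_pos_left hm (div_pos (by linarith) hmg)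
    linarith

include hC in
-- The same difference is nonincreasing, so it is nonnegative below `g`; a zero at `α` would make it
-- negative at `g`.
lemma Terminating.lt_contValue (hfree : ∀ s, ¬ C.IsFree s) {s : S} {g α : ℝ}
    (hg : C.contValue g s = g) (hα : α < g) : α < C.contValue α s := by
  have h1 := hC.contValue_sub_le hα.le s
  rcases (show α ≤ C.contValue α s by linarith).lt_or_eq with h | h
  · exact h
  · exact absurd (hC.contValue_lt hfree h.symm hα) (by rw [hg]; exact lt_irrefl _)

include hC in
lemma Terminating.goOptimal_iff (s : S) (α : ℝ) :
    C.GoOptimal s α ↔ C.contValue α s = C.stopValue α s := by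
  simp only [GoOptimal, hC.localValue_eq_stopValue, contValue]

include hC in
lemma Terminating.quitOptimal_iff (s : S) (α : ℝ) :
    C.QuitOptimal s α ↔ α = C.stopValue α s := by
  simp only [QuitOptimal, hC.localValue_eq_stopValue]

lemma gittins_eq_of_forall_iff {s : S} {g : ℝ}
    (h : ∀ α, C.GoOptimal s α ∧ C.QuitOptimal s α ↔ α = g) : C.gittins s = g := by
  have hex : ∃! g : ℝ, C.GoOptimal s g ∧ C.QuitOptimal s g :=
    ⟨g, (h g).2 rfl, fun α hα => (h α).1 hα⟩
  rw [gittins, dif_pos hex]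
  rw [(h _).1 hex.exists.choose_spec]

include hC in
-- The local value is 0 for every alternative, so `quit` is optimal only for `α = 0`. This value
-- never enters a surrogate value, but it makes the index finite in all states.
lemma Terminating.gittins_of_mem {s : S} (hs : s ∈ C.terminal) : C.gittins s = (0 : ℝ) := by
  refine gittins_eq_of_forall_iff fun α => ?_
  rw [hC.goOptimal_iff, hC.quitOptimal_iff, stopValue_of_mem α hs, contValue,
    C.reward_terminal s hs, C.absorbing s hs,
    integral_dirac' _ _ (measurable_stopValue α).stronglyMeasurable, stopValue_of_mem α hs]
  simp

include hC in
lemma Terminating.gittins_of_notMem (hfree : ∀ s, ¬ C.IsFree s) {s : S} (hs : s ∉ C.terminal)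
    {g : ℝ} (hg : C.contValue g s = g) : C.gittins s = g := by
  refine gittins_eq_of_forall_iff fun α => ?_
  rw [hC.goOptimal_iff, hC.quitOptimal_iff, hC.stopValue_eq_max α hs]
  constructor
  · rintro ⟨h1, h2⟩
    have h3 : C.contValue α s = α := h1.trans h2.symm
    rcases lt_trichotomy α g with h | h | h
    · exact absurd (hC.lt_contValue hfree hg h) (by rw [h3]; exact lt_irrefl _)
    · exact h
    · exact absurd (hC.contValue_lt hfree hg h) (by rw [h3]; exact lt_irrefl _)
  · rintro rfl
    simp [hg]

variable (C) in
/-- The Gittins index as a real number. -/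
def index (s : S) : ℝ := (C.gittins s).toReal

include hC in
lemma Terminating.coe_index (hfree : ∀ s, ¬ C.IsFree s) (s : S) :
    (C.index s : EReal) = C.gittins s := by
  by_cases hs : s ∈ C.terminal
  · rw [index, hC.gittins_of_mem hs, EReal.toReal_coe]
  · obtain ⟨g, hg⟩ := hC.exists_contValue_eq hfree hs
    rw [index, hC.gittins_of_notMem hfree hs hg, EReal.toReal_coe]

include hC in
lemma Terminating.contValue_index (hfree : ∀ s, ¬ C.IsFree s) {s : S} (hs : s ∉ C.terminal) :
    C.contValue (C.index s) s = C.index s := by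
  obtain ⟨g, hg⟩ := hC.exists_contValue_eq hfree hs
  rw [index, hC.gittins_of_notMem hfree hs hg, EReal.toReal_coe, hg]

include hC in
lemma Terminating.lt_contValue_iff (hfree : ∀ s, ¬ C.IsFree s) {s : S} (hs : s ∉ C.terminal)
    (α : ℝ) : α < C.contValue α s ↔ α < C.index s := by
  have hg := hC.contValue_index hfree hs
  refine ⟨fun h => ?_, hC.lt_contValue hfree hg⟩
  by_contra! h'
  rcases h'.lt_or_eq with h' | h'
  · exact absurd (hC.contValue_lt hfree hg h') h.asymm
  · rw [← h', hg] at h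
    exact lt_irrefl _ h

include hC in
lemma Terminating.mem_stopSet_iff (hfree : ∀ s, ¬ C.IsFree s) {s : S} (hs : s ∉ C.terminal)
    (α : ℝ) : s ∈ C.stopSet α ↔ C.index s ≤ α := by
  rw [← not_lt, ← hC.lt_contValue_iff hfree hs α, not_lt]; rfl

include hC in
lemma Terminating.measurable_index (hfree : ∀ s, ¬ C.IsFree s) : Measurable C.index := by
  refine measurable_of_Ioi fun α => ?_
  have : C.index ⁻¹' Set.Ioi α = (C.terminal ∩ {_s | α < 0}) ∪
      (C.terminalᶜ ∩ {s | α < C.contValue α s}) := by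
    ext s
    by_cases hs : s ∈ C.terminal
    · simp [hs, index, hC.gittins_of_mem hs]
    · simp [hs, hC.lt_contValue_iff hfree hs]
  rw [this]
  exact (C.measurableSet_terminal.inter (MeasurableSet.const _)).union
    (C.measurableSet_terminal.compl.inter (measurableSet_lt measurable_const
      (measurable_contValue α)))

end RewardChain

/-- A function whose increments are controlled to second order is constant. -/
lemma eq_of_abs_sub_le_mul_sub {f b : ℝ → ℝ}
    (h : ∀ x y, x ≤ y → |f y - f x| ≤ (y - x) * (b y - b x)) {x y : ℝ} (hxy : x ≤ y) :
    f x = f y := by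
  -- Bisection: both halves have half the length, and the increments of `b` over them add up, so
  -- every round halves the bound.
  have key : ∀ n : ℕ, ∀ x y, x ≤ y → |f y - f x| ≤ (y - x) * (b y - b x) * (1 / 2) ^ n := by
    intro n
    induction n with
    | zero => simpa using h
    | succ n ih =>
      intro x y hxy
      have h2 := ih x ((x + y) / 2) (by linarith)
      have h3 := ih ((x + y) / 2) y (by linarith)
      have h4 := abs_sub_le (f y) (f ((x + y) / 2)) (f x)
      calc |f y - f x| ≤ _ := h4
        _ ≤ _ := add_le_add h3 h2
        _ = _ := by ring
  have hlim : Filter.Tendsto (fun n : ℕ => (y - x) * (b y - b x) * (1 / 2 : ℝ) ^ n) Filter.atTop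
      (nhds 0) := by
    simpa using (tendsto_pow_atTop_nhds_zero_of_lt_one (r := (1 / 2 : ℝ)) (by norm_num)
      (by norm_num)).const_mul ((y - x) * (b y - b x))
  have h2 : |f y - f x| ≤ 0 := ge_of_tendsto' hlim fun n => key n x y hxy
  exact (sub_eq_zero.1 (abs_nonpos_iff.1 h2)).symm

/-! ### The surrogate value and the local value -/

namespace RewardChain

open Filter Topology ENNReal

variable {S : Type*} [MeasurableSpace S] {C : RewardChain S} (hC : C.Terminating)
  (hfree : ∀ s, ¬ C.IsFree s)

include hC hfree in
lemma Terminating.measurable_gittins : Measurable C.gittins := by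
  simp only [← funext (hC.coe_index hfree)]
  exact measurable_coe_real_ereal.comp (hC.measurable_index hfree)

include hC hfree in
lemma Terminating.measurable_surrogate : Measurable C.surrogate := by
  classical
  refine Measurable.iInf fun t => ?_
  have : (fun x : ℕ → S => ⨅ (_ : t ∈ timesBefore C.terminal x), C.gittins (x t)) =
      fun x => if t ∈ timesBefore C.terminal x then C.gittins (x t) else ⊤ := by
    funext x
    split_ifs with h <;> simp [h]
  rw [this]
  exact Measurable.ite (measurableSet_mem_timesBefore C.measurableSet_terminal t)
    ((hC.measurable_gittins hfree).comp (measurable_pi_apply t)) measurable_const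

include hC hfree in
lemma Terminating.surrogate_ne_bot {x : ℕ → S} (hx : ∃ t, x t ∈ C.terminal) :
    C.surrogate x ≠ ⊥ := by
  obtain ⟨N, hN⟩ := hx
  have h : ((-∑ t ∈ Finset.range N, |C.index (x t)| : ℝ) : EReal) ≤ C.surrogate x := by
    refine le_iInf₂ fun t ht => ?_
    rw [← hC.coe_index hfree, EReal.coe_le_coe_iff]
    have htN : t < N := by
      by_contra! h
      exact ht N h hN
    have := Finset.single_le_sum (f := fun t => |C.index (x t)|) (fun _ _ => abs_nonneg _)
      (Finset.mem_range.2 htN)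
    linarith [neg_abs_le (C.index (x t))]
  intro hbot
  rw [hbot] at h
  exact absurd (le_bot_iff.1 h) (EReal.coe_ne_bot _)

include hC hfree in
lemma Terminating.ae_surrogate_le {s : S} (hs : s ∉ C.terminal) :
    ∀ᵐ x ∂(pathLaw C.kernel s), C.surrogate x ≤ C.gittins s := by
  have hm : MeasurableSet {s' | s' ∉ C.terminal ∧ C.gittins s' ≤ C.gittins s} :=
    C.measurableSet_terminal.compl.inter
      (measurableSet_le (hC.measurable_gittins hfree) measurable_const)
  filter_upwards [ae_pathLaw_zero C.kernel hm ⟨hs, le_rfl⟩] with x hx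
  refine (iInf₂_le 0 ?_).trans hx.2
  intro u hu
  obtain rfl : u = 0 := by omega
  exact hx.1

include hC hfree in
lemma Terminating.ae_surrogate_finite {s : S} (hs : s ∉ C.terminal) :
    ∀ᵐ x ∂(pathLaw C.kernel s), C.surrogate x ≠ ⊥ ∧ C.surrogate x ≠ ⊤ := by
  filter_upwards [(hC s).1, hC.ae_surrogate_le hfree hs] with x h1 h2
  refine ⟨hC.surrogate_ne_bot hfree h1, fun h => ?_⟩
  rw [h, ← hC.coe_index hfree] at h2
  exact absurd (top_le_iff.1 h2) (EReal.coe_ne_top _)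

variable (C) in
/-- The surrogate value as a real number. -/
def surr (x : ℕ → S) : ℝ := (C.surrogate x).toReal

include hC hfree in
lemma Terminating.measurable_surr : Measurable C.surr :=
  measurable_ereal_toReal.comp (hC.measurable_surrogate hfree)

include hC hfree in
lemma Terminating.ae_coe_surr {s : S} (hs : s ∉ C.terminal) :
    ∀ᵐ x ∂(pathLaw C.kernel s), (C.surr x : EReal) = C.surrogate x := by
  filter_upwards [hC.ae_surrogate_finite hfree hs] with x hx
  exact EReal.coe_toReal hx.2 hx.1

include hC hfree in
lemma Terminating.ae_surr_le {s : S} (hs : s ∉ C.terminal) :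
    ∀ᵐ x ∂(pathLaw C.kernel s), C.surr x ≤ C.index s := by
  filter_upwards [hC.ae_surrogate_le hfree hs, hC.ae_coe_surr hfree hs] with x h1 h2
  rw [← EReal.coe_le_coe_iff, h2, hC.coe_index hfree]
  exact h1

include hC hfree in
-- The index bounds the surrogate value above and `α` truncates it below. Integrability without
-- truncation is derived later from the resulting formula.
lemma Terminating.integrable_max_surr (α : ℝ) {s : S} (hs : s ∉ C.terminal) :
    Integrable (fun x => max α (C.surr x)) (pathLaw C.kernel s) := by
  refine (integrable_const (|α| + |C.index s|)).mono'
    (measurable_const.max (hC.measurable_surr hfree)).aestronglyMeasurable ?_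
  filter_upwards [hC.ae_surr_le hfree hs] with x hx
  rw [Real.norm_eq_abs, abs_le]
  have h1 := neg_abs_le α
  have h2 := le_abs_self α
  have h3 := le_abs_self (C.index s)
  have h4 := abs_nonneg (C.index s)
  have h5 := abs_nonneg α
  exact ⟨le_trans (by linarith) (le_max_left _ _), max_le (by linarith) (by linarith)⟩

include hC hfree in
-- A path that meets the stopping set of `α` has surrogate value at most `α`, so raising the
-- alternative gains all of `β - α`.
lemma Terminating.ae_mul_indicator_hit_le {α β : ℝ} (h : α ≤ β) {s : S} (hs : s ∉ C.terminal) :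
    ∀ᵐ x ∂(pathLaw C.kernel s),
      {x | ∃ t ∈ timesBefore C.terminal x, x t ∈ C.stopSet α}.indicator (fun _ => β - α) x ≤
        max β (C.surr x) - max α (C.surr x) := by
  filter_upwards [hC.ae_coe_surr hfree hs] with x hx
  by_cases hh : x ∈ {x | ∃ t ∈ timesBefore C.terminal x, x t ∈ C.stopSet α}
  · rw [Set.indicator_of_mem hh]
    obtain ⟨t, ht, hxt⟩ := hh
    have h1 : C.index (x t) ≤ α := (hC.mem_stopSet_iff hfree (ht t le_rfl) α).1 hxt
    have h2 : C.surr x ≤ C.index (x t) := by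
      rw [← EReal.coe_le_coe_iff, hx, hC.coe_index hfree]
      exact iInf₂_le t ht
    rw [max_eq_left (h2.trans h1)]
    linarith [le_max_left β (C.surr x)]
  · rw [Set.indicator_of_notMem hh]
    linarith [max_le_max h (le_refl (C.surr x))]

include hC hfree in
-- A path that misses the stopping set of `β` has surrogate value at least `β`, so neither
-- alternative matters.
lemma Terminating.ae_le_mul_indicator_hit {α β : ℝ} (h : α ≤ β) {s : S} (hs : s ∉ C.terminal) :
    ∀ᵐ x ∂(pathLaw C.kernel s), max β (C.surr x) - max α (C.surr x) ≤
      {x | ∃ t ∈ timesBefore C.terminal x, x t ∈ C.stopSet β}.indicator (fun _ => β - α) x := by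
  filter_upwards [hC.ae_coe_surr hfree hs] with x hx
  by_cases hh : x ∈ {x | ∃ t ∈ timesBefore C.terminal x, x t ∈ C.stopSet β}
  · rw [Set.indicator_of_mem hh]
    have h1 := le_max_left α (C.surr x)
    have h2 := le_max_right α (C.surr x)
    have h3 : max β (C.surr x) ≤ max α (C.surr x) + (β - α) :=
      max_le (by linarith) (by linarith)
    linarith
  · rw [Set.indicator_of_notMem hh]
    have h1 : (β : EReal) ≤ C.surrogate x := by
      refine le_iInf₂ fun t ht => ?_
      have h2 : ¬ C.index (x t) ≤ β := fun h2 =>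
        hh ⟨t, ht, (hC.mem_stopSet_iff hfree (ht t le_rfl) β).2 h2⟩
      rw [← hC.coe_index hfree, EReal.coe_le_coe_iff]
      exact (not_le.1 h2).le
    rw [← hx, EReal.coe_le_coe_iff] at h1
    rw [max_eq_right h1, max_eq_right (h.trans h1), sub_self]

include hC hfree in
/-- The optimal value of the local MDP in terms of the surrogate value. -/
theorem Terminating.integral_max_surr (α : ℝ) {s : S} (hs : s ∉ C.terminal) :
    ∫ x, max α (C.surr x) ∂(pathLaw C.kernel s) = C.stopValue α s := by
  set H : ℝ → ℝ := fun α => ∫ x, max α (C.surr x) ∂(pathLaw C.kernel s) with hH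
  have hint := fun α => hC.integrable_max_surr hfree α hs
  have hind : ∀ γ c : ℝ, ∫ x, {x | ∃ t ∈ timesBefore C.terminal x, x t ∈ C.stopSet γ}.indicator
      (fun _ => c) x ∂(pathLaw C.kernel s) = c * C.hitProb (C.stopSet γ) s := by
    intro γ c
    rw [integral_indicator_const _ (measurableSet_hit (measurableSet_stopSet γ)), smul_eq_mul,
      mul_comm]
    rfl
  have hindint : ∀ γ c : ℝ, Integrable ({x | ∃ t ∈ timesBefore C.terminal x,
      x t ∈ C.stopSet γ}.indicator (fun _ => c)) (pathLaw C.kernel s) := fun γ c =>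
    (integrable_const c).indicator (measurableSet_hit (measurableSet_stopSet γ))
  have h1 : ∀ α β, α ≤ β → (β - α) * C.hitProb (C.stopSet α) s ≤ H β - H α := by
    intro α β h
    rw [← hind, hH]
    dsimp only
    rw [← integral_sub (hint β) (hint α)]
    exact integral_mono_ae (hindint _ _) ((hint β).sub (hint α))
      (hC.ae_mul_indicator_hit_le hfree h hs)
  have h2 : ∀ α β, α ≤ β → H β - H α ≤ (β - α) * C.hitProb (C.stopSet β) s := by
    intro α β h
    rw [← hind, hH]
    dsimp only
    rw [← integral_sub (hint β) (hint α)]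
    exact integral_mono_ae ((hint β).sub (hint α)) (hindint _ _)
      (hC.ae_le_mul_indicator_hit hfree h hs)
  -- The increments of both functions lie in the same interval, whose length is `y - x` times the
  -- increment of the hitting probability.
  have hconst := fun x y (hxy : x ≤ y) => eq_of_abs_sub_le_mul_sub
    (f := fun α => C.stopValue α s - H α) (b := fun α => C.hitProb (C.stopSet α) s)
    (fun x y hxy => by
      have h3 := h1 x y hxy
      have h4 := h2 x y hxy
      have h5 := hC.mul_hitProb_le hxy s
      have h6 := hC.le_mul_hitProb hxy s
      rw [mul_sub, abs_le]
      constructor <;> linarith) hxy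
  -- The constant is read off at an alternative not below the index: stopping at once is optimal
  -- there and the surrogate value does not exceed it.
  have h3 := hconst α (max α (C.index s)) (le_max_left _ _)
  have h4 : C.stopValue (max α (C.index s)) s = max α (C.index s) :=
    hC.stopValue_of_mem_stopSet hs ((hC.mem_stopSet_iff hfree hs _).2 (le_max_right _ _))
  have h5 : H (max α (C.index s)) = max α (C.index s) := by
    rw [hH]
    dsimp only
    rw [integral_congr_ae (g := fun _ => max α (C.index s))]
    · simp
    · filter_upwards [hC.ae_surr_le hfree hs] with x hx
      exact max_eq_left (hx.trans (le_max_right _ _))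
  simp only [h4, h5, sub_self] at h3
  linarith

include hC hfree in
-- Since |x| = 2 max(0, x) - x, the truncation at `-k` has expected absolute value 2 V(0) - V(-k),
-- at most three weights uniformly in `k`. Fatou's lemma removes the truncation.
lemma Terminating.lintegral_enorm_surr_le {s : S} (hs : s ∉ C.terminal) :
    ∫⁻ x, ‖C.surr x‖ₑ ∂(pathLaw C.kernel s) ≤ ENNReal.ofReal (3 * C.weight s) := by
  have hm := hC.measurable_surr hfree
  have h1 : ∀ k : ℕ, ∫⁻ x, ‖max (-(k : ℝ)) (C.surr x)‖ₑ ∂(pathLaw C.kernel s) ≤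
      ENNReal.ofReal (3 * C.weight s) := by
    intro k
    have hi0 := hC.integrable_max_surr hfree 0 hs
    have hik := hC.integrable_max_surr hfree (-(k : ℝ)) hs
    simp only [Real.enorm_eq_ofReal_abs]
    rw [← ofReal_integral_eq_lintegral_ofReal hik.abs (ae_of_all _ fun x => abs_nonneg _)]
    refine ENNReal.ofReal_le_ofReal ?_
    have h2 : ∀ x, |max (-(k : ℝ)) (C.surr x)| =
        2 * max 0 (C.surr x) - max (-(k : ℝ)) (C.surr x) := by
      intro x
      have hk : -(k : ℝ) ≤ 0 := by simp
      rcases le_total (C.surr x) 0 with h | h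
      · rw [max_eq_left h, abs_of_nonpos (max_le hk h)]
        ring
      · rw [max_eq_right h, max_eq_right (hk.trans h), abs_of_nonneg h]
        ring
    simp only [h2]
    rw [integral_sub (hi0.const_mul 2) hik, integral_const_mul, hC.integral_max_surr hfree 0 hs,
      hC.integral_max_surr hfree _ hs]
    have h3 := (le_abs_self _).trans (hC.abs_stopValue_le 0 s)
    have h4 := hC.neg_weight_le_stopValue (-(k : ℝ)) s
    rw [abs_zero] at h3
    linarith
  have h2 : ∀ x, ‖C.surr x‖ₑ = liminf (fun k : ℕ => ‖max (-(k : ℝ)) (C.surr x)‖ₑ) atTop := by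
    intro x
    refine (Tendsto.liminf_eq (tendsto_const_nhds.congr' ?_)).symm
    obtain ⟨n, hn⟩ := exists_nat_ge (-C.surr x)
    filter_upwards [eventually_ge_atTop n] with k hk
    have : (n : ℝ) ≤ k := by exact_mod_cast hk
    rw [max_eq_right (by linarith)]
  simp only [h2]
  refine (lintegral_liminf_le fun k => (measurable_const.max hm).enorm).trans ?_
  exact (liminf_le_liminf (Eventually.of_forall h1)).trans (by simp)

include hC hfree in
lemma Terminating.integrable_surr {s : S} (hs : s ∉ C.terminal) :
    Integrable C.surr (pathLaw C.kernel s) :=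
  ⟨(hC.measurable_surr hfree).aestronglyMeasurable,
    lt_of_le_of_lt (hC.lintegral_enorm_surr_le hfree hs) ofReal_lt_top⟩

include hC hfree in
lemma Terminating.integral_abs_surr_le {s : S} (hs : s ∉ C.terminal) :
    ∫ x, |C.surr x| ∂(pathLaw C.kernel s) ≤ 3 * C.weight s := by
  have h := hC.lintegral_enorm_surr_le hfree hs
  simp only [Real.enorm_eq_ofReal_abs] at h
  rwa [← ofReal_integral_eq_lintegral_ofReal (hC.integrable_surr hfree hs).abs
    (ae_of_all _ fun x => abs_nonneg _), ENNReal.ofReal_le_ofReal_iff (by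
      have := weight_nonneg (C := C) s; positivity)] at h

/-! ### The local problem with an extended alternative -/

variable (C) in
open Classical in
/-- The expected maximum of `m` and the surrogate value; it vanishes in terminal states. -/
def maxValue (m : EReal) (s : S) : ℝ :=
  if s ∈ C.terminal then 0 else ∫ x, (max m (C.surrogate x)).toReal ∂(pathLaw C.kernel s)

lemma maxValue_of_mem (m : EReal) {s : S} (hs : s ∈ C.terminal) : C.maxValue m s = 0 := by
  simp [maxValue, hs]

lemma maxValue_of_notMem (m : EReal) {s : S} (hs : s ∉ C.terminal) :
    C.maxValue m s = ∫ x, (max m (C.surrogate x)).toReal ∂(pathLaw C.kernel s) := by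
  simp [maxValue, hs]

lemma abs_toReal_max_le (m y : EReal) :
    |(max m y).toReal| ≤ |m.toReal| + |y.toReal| := by
  rcases max_choice m y with h | h <;> rw [h]
  · linarith [abs_nonneg y.toReal]
  · linarith [abs_nonneg m.toReal]

include hC hfree in
lemma Terminating.measurable_maxValue :
    Measurable (fun p : EReal × S => C.maxValue p.1 p.2) := by
  classical
  refine Measurable.ite (measurable_snd C.measurableSet_terminal) measurable_const ?_
  have hm : Measurable (fun p : (EReal × S) × (ℕ → S) =>
      (max p.1.1 (C.surrogate p.2)).toReal) :=
    measurable_ereal_toReal.comp ((measurable_fst.comp measurable_fst).max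
      ((hC.measurable_surrogate hfree).comp measurable_snd))
  exact (hm.stronglyMeasurable.integral_kernel_prod_right
    (κ := (pathKernel C.kernel).comap Prod.snd measurable_snd)).measurable

include hC hfree in
lemma Terminating.abs_maxValue_le (m : EReal) (s : S) :
    |C.maxValue m s| ≤ |m.toReal| + 3 * C.weight s := by
  by_cases hs : s ∈ C.terminal
  · rw [maxValue_of_mem m hs, abs_zero]
    have := weight_nonneg (C := C) s
    positivity
  · rw [maxValue_of_notMem m hs]
    have hi := (hC.integrable_surr hfree hs).abs
    refine abs_integral_le_integral_abs.trans ((integral_mono_of_nonneg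
      (ae_of_all _ fun x => abs_nonneg _) ((integrable_const |m.toReal|).add hi)
      (ae_of_all _ fun x => abs_toReal_max_le m (C.surrogate x))).trans ?_)
    simp only [Pi.add_apply]
    change ∫ x, |m.toReal| + |C.surr x| ∂(pathLaw C.kernel s) ≤ _
    rw [integral_add (integrable_const _) hi]
    simpa using hC.integral_abs_surr_le hfree hs

include hC hfree in
lemma Terminating.maxValue_coe (α : ℝ) (s : S) : C.maxValue α s = C.stopValue α s := by
  by_cases hs : s ∈ C.terminal
  · rw [maxValue_of_mem _ hs, stopValue_of_mem α hs]
  · rw [maxValue_of_notMem _ hs, ← hC.integral_max_surr hfree α hs]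
    refine integral_congr_ae ?_
    filter_upwards [hC.ae_coe_surr hfree hs] with x hx
    rw [← hx, ← EReal.coe_strictMono.monotone.map_max, EReal.toReal_coe]

include hC in
lemma Terminating.abs_stopValue_neg_le (k : ℕ) (s : S) :
    |C.stopValue (-(k : ℝ)) s| ≤ 0 + 3 * C.weight s := by
  have h1 := hC.neg_weight_le_stopValue (-(k : ℝ)) s
  have h2 := hC.stopValue_mono (α := -(k : ℝ)) (β := 0) (by simp) s
  have h3 := (le_abs_self _).trans (hC.abs_stopValue_le 0 s)
  have h4 := weight_nonneg (C := C) s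
  rw [abs_zero] at h3
  rw [abs_le]
  constructor <;> linarith

include hC hfree in
lemma Terminating.tendsto_stopValue_neg (s : S) :
    Tendsto (fun k : ℕ => C.stopValue (-(k : ℝ)) s) atTop (𝓝 (C.maxValue ⊥ s)) := by
  by_cases hs : s ∈ C.terminal
  · simp [maxValue_of_mem _ hs, stopValue_of_mem _ hs]
  · simp only [← hC.integral_max_surr hfree _ hs, maxValue_of_notMem _ hs, bot_le, max_eq_right]
    refine tendsto_integral_of_dominated_convergence (fun x => |C.surr x|)
      (fun k => (measurable_const.max (hC.measurable_surr hfree)).aestronglyMeasurable)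
      (hC.integrable_surr hfree hs).abs (fun k => ae_of_all _ fun x => ?_)
      (ae_of_all _ fun x => ?_)
    · rw [Real.norm_eq_abs, abs_le]
      have h1 : -(k : ℝ) ≤ 0 := by simp
      exact ⟨(neg_abs_le _).trans (le_max_right _ _),
        max_le (h1.trans (abs_nonneg _)) (le_abs_self _)⟩
    · refine tendsto_const_nhds.congr' ?_
      obtain ⟨n, hn⟩ := exists_nat_ge (-C.surr x)
      filter_upwards [eventually_ge_atTop n] with k hk
      have : (n : ℝ) ≤ k := by exact_mod_cast hk
      rw [max_eq_right (by linarith)]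
      rfl

include hC hfree in
-- The alternative `⊥` arises when there is no other chain. Once `-k` is below the index, `go` is
-- optimal against it, and the equation passes to the limit in `k`.
lemma Terminating.maxValue_bot {s : S} (hs : s ∉ C.terminal) :
    C.reward s + ∫ s', C.maxValue ⊥ s' ∂(C.kernel s) = C.maxValue ⊥ s := by
  have h1 : Tendsto (fun k : ℕ => C.contValue (-(k : ℝ)) s) atTop
      (𝓝 (C.reward s + ∫ s', C.maxValue ⊥ s' ∂(C.kernel s))) := by
    refine tendsto_const_nhds.add (tendsto_integral_of_dominated_convergence
      (fun s' => 0 + 3 * C.weight s') (fun k => (measurable_stopValue _).aestronglyMeasurable)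
      ((integrable_const _).add ((hC.integrable_weight s).const_mul 3))
      (fun k => ae_of_all _ fun s' => hC.abs_stopValue_neg_le k s')
      (ae_of_all _ fun s' => hC.tendsto_stopValue_neg hfree s'))
  refine tendsto_nhds_unique h1 ((hC.tendsto_stopValue_neg hfree s).congr' ?_)
  obtain ⟨n, hn⟩ := exists_nat_gt (-C.index s)
  filter_upwards [eventually_ge_atTop n] with k hk
  have : (n : ℝ) ≤ k := by exact_mod_cast hk
  rw [hC.stopValue_eq_max _ hs]
  exact max_eq_right ((hC.lt_contValue_iff hfree hs _).2 (by linarith)).le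

include hC hfree in
theorem Terminating.step_maxValue_le {m : EReal} (hm : m ≠ ⊤) {s : S} (hs : s ∉ C.terminal) :
    C.reward s + ∫ s', C.maxValue m s' ∂(C.kernel s) ≤ C.maxValue m s := by
  induction m with
  | bot => exact (hC.maxValue_bot hfree hs).le
  | top => exact absurd rfl hm
  | coe α =>
    simp only [hC.maxValue_coe hfree]
    exact hC.contValue_le_stopValue α hs

include hC hfree in
theorem Terminating.step_maxValue_eq_iff {m : EReal} (hm : m ≠ ⊤) {s : S}
    (hs : s ∉ C.terminal) :
    C.reward s + ∫ s', C.maxValue m s' ∂(C.kernel s) = C.maxValue m s ↔ m ≤ C.gittins s := by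
  induction m with
  | bot => simpa using hC.maxValue_bot hfree hs
  | top => exact absurd rfl hm
  | coe α =>
    simp only [hC.maxValue_coe hfree]
    rw [← hC.coe_index hfree, EReal.coe_le_coe_iff, hC.stopValue_eq_max α hs]
    change C.contValue α s = _ ↔ _
    rw [eq_comm, max_eq_right_iff]
    have hg := hC.contValue_index hfree hs
    constructor
    · intro h
      by_contra! h'
      exact absurd (hC.contValue_lt hfree hg h') (not_lt.2 h)
    · intro h
      rcases h.lt_or_eq with h | h
      · exact (hC.lt_contValue hfree hg h).le
      · rw [h, hg]

include hC hfree in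
/-- The surrogate value exceeds every number below the Gittins index with positive probability. -/
lemma Terminating.le_of_ae_surrogate_le {s : S} (hs : s ∉ C.terminal) {g : EReal}
    (h : ∀ᵐ x ∂(pathLaw C.kernel s), C.surrogate x ≤ g) : C.gittins s ≤ g := by
  by_contra! hlt
  -- For a real `α` strictly between, the surrogate value would almost surely not exceed `α`. The
  -- local value would then be `α`, although continuing is worth more.
  obtain ⟨α, h1, h2⟩ := EReal.lt_iff_exists_real_btwn.1 hlt
  rw [← hC.coe_index hfree, EReal.coe_lt_coe_iff] at h2
  have h3 := (hC.lt_contValue_iff hfree hs α).2 h2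
  have h4 := hC.contValue_le_stopValue α hs
  rw [← hC.integral_max_surr hfree α hs, integral_congr_ae (g := fun _ => α)] at h4
  · simp only [integral_const, probReal_univ, one_smul] at h4
    linarith
  · filter_upwards [h, hC.ae_coe_surr hfree hs] with x hx hx'
    rw [← hx'] at hx
    exact max_eq_left (EReal.coe_le_coe_iff.1 (hx.trans h1.le))

end RewardChain

/-! ### Termination and integrability of Markov chain selection -/

section SelectionTermination

open Filter Topology ENNReal

variable {n : ℕ} {S : Fin n → Type*} [∀ i, MeasurableSpace (S i)] {C : ∀ i, RewardChain (S i)}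
  (hC : ∀ i, (C i).Terminating)

lemma selectionMDP_policyKernel_apply (π : Policy (∀ i, S i) (Fin n)) (s : ∀ i, S i) :
    (selectionMDP C).policyKernel π s =
      ((C (π.1 s)).kernel (s (π.1 s))).map (Function.update s (π.1 s)) := rfl

omit [∀ i, MeasurableSpace (S i)] in
lemma sum_update {M : Type*} [AddCommMonoid M] (g : ∀ i, S i → M) (s : ∀ i, S i) (a : Fin n)
    (s' : S a) :
    ∑ j, g j (Function.update s a s' j) = g a s' + ∑ j ∈ Finset.univ.erase a, g j (s j) := by
  rw [← Finset.add_sum_erase _ _ (Finset.mem_univ a), Function.update_self]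
  congr 1
  refine Finset.sum_congr rfl fun j hj => ?_
  rw [Function.update_of_ne (Finset.ne_of_mem_erase hj)]

lemma lintegral_policyKernel {g : (∀ i, S i) → ℝ≥0∞} (hg : Measurable g)
    (π : Policy (∀ i, S i) (Fin n)) (s : ∀ i, S i) :
    ∫⁻ z, g z ∂((selectionMDP C).policyKernel π s) =
      ∫⁻ s', g (Function.update s (π.1 s) s') ∂((C (π.1 s)).kernel (s (π.1 s))) := by
  rw [selectionMDP_policyKernel_apply, lintegral_map hg (measurable_update _)]

lemma lintegral_sum_policyKernel {g : ∀ i, S i → ℝ≥0∞} (hg : ∀ i, Measurable (g i))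
    (π : Policy (∀ i, S i) (Fin n)) (s : ∀ i, S i) :
    ∫⁻ z, ∑ j, g j (z j) ∂((selectionMDP C).policyKernel π s) =
      ∫⁻ s', g (π.1 s) s' ∂((C (π.1 s)).kernel (s (π.1 s))) +
        ∑ j ∈ Finset.univ.erase (π.1 s), g j (s j) := by
  have hm : Measurable fun z : ∀ i, S i => ∑ j, g j (z j) := Finset.measurable_sum _ fun j _ =>
    (hg j).comp (measurable_pi_apply j)
  rw [lintegral_policyKernel hm]
  simp only [sum_update g]
  rw [lintegral_add_right _ measurable_const]
  simp

lemma notMem_terminal {s : ∀ i, S i} (hs : s ∉ (selectionMDP C).terminal) (i : Fin n) :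
    s i ∉ (C i).terminal := fun h => hs ⟨i, h⟩

/-- The sum over all chains of the expected absolute values of the rewards. -/
def selectionWeight (C : ∀ i, RewardChain (S i)) (s : ∀ i, S i) : ℝ≥0∞ :=
  ∑ i, ENNReal.ofReal ((C i).weight (s i))

/-- Only the played chain makes a step and the others are frozen, so sums of excessive functions of
the single chains are excessive under every policy. -/
lemma killed_sum_le {u v : ∀ i, S i → ℝ≥0∞} (hu : ∀ i, Measurable (u i))
    (π : Policy (∀ i, S i) (Fin n)) {s : ∀ i, S i}
    (h : killed (C (π.1 s)).kernel (C (π.1 s)).terminal (u (π.1 s)) (s (π.1 s)) ≤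
      v (π.1 s) (s (π.1 s)))
    (h' : ∀ j ≠ π.1 s, u j (s j) ≤ v j (s j)) :
    killed ((selectionMDP C).policyKernel π) (selectionMDP C).terminal
      (fun z => ∑ i, u i (z i)) s ≤ ∑ i, v i (s i) := by
  by_cases hs : s ∈ (selectionMDP C).terminal
  · rw [killed_of_mem hs]; exact bot_le
  · rw [killed_of_notMem hs, lintegral_sum_policyKernel hu,
      ← killed_of_notMem (notMem_terminal hs (π.1 s)),
      ← Finset.add_sum_erase _ _ (Finset.mem_univ (π.1 s))]
    exact add_le_add h (Finset.sum_le_sum fun j hj => h' j (Finset.ne_of_mem_erase hj))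

include hC in
lemma smallTails_selection (π : Policy (∀ i, S i) (Fin n)) :
    SmallTails ((selectionMDP C).policyKernel π) (selectionMDP C).terminal
      (selectionWeight C) := by
  choose Ψ hm hex hlim b hle using fun i => (hC i).smallTails
  refine ⟨fun c s => ∑ i, Ψ i c (s i), fun c => Finset.measurable_sum _ fun i _ =>
    (hm i c).comp (measurable_pi_apply i), fun c s => ?_, fun s => ?_, ∑ i, b i, fun c s => ?_⟩
  · exact killed_sum_le (u := fun i => Ψ i c) (v := fun i => Ψ i c) (fun i => hm i c) π
      (hex _ c _) fun _ _ => le_rfl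
  · simpa using tendsto_finsetSum Finset.univ fun i _ => hlim i (s i)
  · rw [Nat.cast_sum, Finset.sum_mul, ← Finset.sum_add_distrib]
    exact Finset.sum_le_sum fun i _ => hle i c (s i)

include hC in
lemma absValue_selection_le (π : Policy (∀ i, S i) (Fin n)) (s : ∀ i, S i) :
    absValue ((selectionMDP C).policyKernel π) (selectionMDP C).terminal
      ((selectionMDP C).policyReward π) s ≤ selectionWeight C s := by
  refine absValue_le (selectionMDP C).measurableSet_terminal (RewardChain.measurable_policyReward _ π)
    (fun s hs => ?_) s
  have hm : ∀ i, Measurable fun s => ENNReal.ofReal ((C i).weight s) := fun i =>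
    RewardChain.measurable_weight.ennreal_ofReal
  unfold selectionWeight
  rw [lintegral_sum_policyKernel hm, ← Finset.add_sum_erase _ _ (Finset.mem_univ (π.1 s)),
    ← add_assoc]
  refine add_le_add (le_of_eq ?_) le_rfl
  simp only [(hC _).ofReal_weight]
  rw [absValue_of_notMem (C _).measurableSet_terminal (C _).measurable_reward
    (notMem_terminal hs _)]
  rfl

lemma iterate_killed_one_antitone {X : Type*} [MeasurableSpace X] {κ : Kernel X X}
    [IsMarkovKernel κ] {D : Set X} (s : X) : Antitone fun t => (killed κ D)^[t] 1 s := by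
  have h1 : killed κ D 1 ≤ 1 := by
    intro s
    by_cases hs : s ∈ D
    · simp [killed_of_mem hs]
    · simp [killed_of_notMem hs]
  have h := (killed_mono (κ := κ) (D := D)).antitone_iterate_of_map_le h1
  exact fun t t' htt => h htt s

/-- Pigeonhole and a union bound: if play survives `N` rounds, some chain `i` has survived `k i` of
its own steps. In the induction `k` is a budget: each play uses up one unit, and an exhausted budget
contributes a summand 1. -/
lemma iterate_killed_selection_le (hn : 0 < n) (π : Policy (∀ i, S i) (Fin n)) (N : ℕ)
    (k : Fin n → ℕ) (hk : ∑ i, k i ≤ N) (s : ∀ i, S i) :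
    (killed ((selectionMDP C).policyKernel π) (selectionMDP C).terminal)^[N] 1 s ≤
      ∑ i, (killed (C i).kernel (C i).terminal)^[k i] 1 (s i) := by
  induction N generalizing k s with
  | zero =>
    have h0 : k ⟨0, hn⟩ = 0 := by
      have := Finset.single_le_sum (f := k) (fun _ _ => Nat.zero_le _)
        (Finset.mem_univ ⟨0, hn⟩)
      omega
    refine le_trans ?_ (Finset.single_le_sum (f := fun i =>
      (killed (C i).kernel (C i).terminal)^[k i] 1 (s i)) (fun _ _ => bot_le)
      (Finset.mem_univ ⟨0, hn⟩))
    simp [h0]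
  | succ N ih =>
    by_cases h0 : ∃ i, k i = 0
    · obtain ⟨i, hi⟩ := h0
      refine le_trans ?_ (Finset.single_le_sum (f := fun i =>
        (killed (C i).kernel (C i).terminal)^[k i] 1 (s i)) (fun _ _ => bot_le)
        (Finset.mem_univ i))
      rw [hi]
      exact iterate_killed_one_antitone s (Nat.zero_le (N + 1))
    · push Not at h0
      set a := π.1 s with ha
      have hsum : ∑ i, Function.update k a (k a - 1) i ≤ N := by
        rw [Finset.sum_update_of_mem (Finset.mem_univ a), Finset.sdiff_singleton_eq_erase]
        rw [← Finset.add_sum_erase _ _ (Finset.mem_univ a)] at hk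
        have := h0 a
        omega
      rw [Function.iterate_succ_apply']
      refine (killed_mono (ih _ hsum) s).trans ?_
      refine killed_sum_le (u := fun i => (killed (C i).kernel (C i).terminal)^[
        Function.update k a (k a - 1) i] 1) (v := fun i =>
        (killed (C i).kernel (C i).terminal)^[k i] 1) (fun i => measurable_iterate_killed
          (C i).measurableSet_terminal measurable_one _) π ?_ ?_
      · rw [← ha, Function.update_self, ← Function.iterate_succ_apply' (killed _ _),
          Nat.succ_eq_add_one, Nat.sub_add_cancel (Nat.pos_of_ne_zero (h0 a))]
      · intro j hj
        rw [Function.update_of_ne hj]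

include hC in
theorem selection_terminates (hn : 0 < n) (π : Policy (∀ i, S i) (Fin n)) (s : ∀ i, S i) :
    TerminatesIntegrably ((selectionMDP C).policyKernel π) (selectionMDP C).terminal
      ((selectionMDP C).policyReward π) s := by
  constructor
  · rw [ae_exists_mem_iff (selectionMDP C).measurableSet_terminal, ENNReal.tendsto_nhds_zero]
    intro ε hε
    have h1 : Tendsto (fun m => ∑ i, (killed (C i).kernel (C i).terminal)^[m] 1 (s i)) atTop
        (𝓝 0) := by
      simpa using tendsto_finsetSum Finset.univ fun i _ =>
        (hC i (s i)).tendsto (C i).measurableSet_terminal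
    obtain ⟨m, hm⟩ := ((ENNReal.tendsto_nhds_zero.1 h1) ε hε).exists
    filter_upwards [eventually_ge_atTop (n * m)] with N hN
    exact (iterate_killed_selection_le hn π N (fun _ => m) (by simpa using hN) s).trans hm
  · refine lt_of_le_of_lt (absValue_selection_le hC π s) ?_
    exact ENNReal.sum_lt_top.2 fun i _ => ofReal_lt_top

end SelectionTermination

open Filter Topology ENNReal

lemma abs_toReal_iSup_le {ι : Type*} [Fintype ι] (f : ι → EReal) :
    |(⨆ i, f i).toReal| ≤ ∑ i, |(f i).toReal| := by
  rcases isEmpty_or_nonempty ι with h | h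
  · simp
  · obtain ⟨i, hi⟩ := exists_eq_ciSup_of_finite (f := f)
    rw [← hi]
    exact Finset.single_le_sum (f := fun i => |(f i).toReal|) (fun _ _ => abs_nonneg _)
      (Finset.mem_univ i)

/-! ### The expected maximal surrogate value solves the Bellman equation -/

section SelectionValue

variable {n : ℕ} {S : Fin n → Type*} [∀ i, MeasurableSpace (S i)] {C : ∀ i, RewardChain (S i)}
  (hC : ∀ i, (C i).Terminating) (hfree : ∀ i s, ¬ (C i).IsFree s)

instance (s : ∀ i, S i) : IsProbabilityMeasure (jointLaw C s) := by
  unfold jointLaw; infer_instance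

lemma measurable_jointLaw : Measurable (jointLaw C) := by
  refine Measurable.measure_of_isPiSystem_of_isProbabilityMeasure generateFrom_pi.symm
    isPiSystem_pi ?_
  rintro _ ⟨t, ht, rfl⟩
  simp only [jointLaw, Measure.pi_pi]
  refine Finset.measurable_prod _ fun i _ => ?_
  exact (Kernel.measurable_coe (pathKernel (C i).kernel) (ht i (Set.mem_univ i))).comp
    (measurable_pi_apply i)

/-- The joint law of the trajectories of all chains but the `i`-th one. -/
def othersLaw (C : ∀ i, RewardChain (S i)) (i : Fin n) (s : ∀ i, S i) :
    Measure (∀ j : {j // j ≠ i}, ℕ → S j) :=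
  Measure.pi fun j => pathLaw (C j).kernel (s j)

instance (i : Fin n) (s : ∀ i, S i) : IsProbabilityMeasure (othersLaw C i s) := by
  unfold othersLaw; infer_instance

lemma othersLaw_update (i : Fin n) (s : ∀ i, S i) (s' : S i) :
    othersLaw C i (Function.update s i s') = othersLaw C i s := by
  unfold othersLaw
  congr 1
  funext j
  rw [Function.update_of_ne j.2]

/-- The maximal surrogate value of the chains other than the `i`-th one. -/
def othersMax (C : ∀ i, RewardChain (S i)) (i : Fin n) (y : ∀ j : {j // j ≠ i}, ℕ → S j) : EReal :=
  ⨆ j : {j // j ≠ i}, (C j).surrogate (y j)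

lemma measurePreserving_split (i : Fin n) (s : ∀ i, S i) :
    MeasurePreserving (fun x : ∀ i, ℕ → S i => ((fun j : {j // j ≠ i} => x j), x i))
      (jointLaw C s) ((othersLaw C i s).prod (pathLaw (C i).kernel (s i))) := by
  have h1 := measurePreserving_piEquivPiSubtypeProd
    (fun i => pathLaw (C i).kernel (s i)) (fun j => j ≠ i)
  have h2 := measurePreserving_eval
    (fun j : {j // ¬ j ≠ i} => pathLaw (C j).kernel (s j)) ⟨i, by simp⟩
  exact ((MeasurePreserving.id _).prod h2).comp h1

lemma maxSurrogate_eq_max (i : Fin n) (x : ∀ i, ℕ → S i) :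
    maxSurrogate C x = max (othersMax C i fun j => x j) ((C i).surrogate (x i)) := by
  refine le_antisymm (iSup_le fun j => ?_) (max_le (iSup_le fun j => ?_) ?_)
  · by_cases hj : j = i
    · subst hj; exact le_max_right _ _
    · exact (le_iSup (fun j : {j // j ≠ i} => (C j).surrogate (x j)) ⟨j, hj⟩).trans
        (le_max_left _ _)
  · exact le_iSup (fun j => (C j).surrogate (x j)) j.1
  · exact le_iSup (fun j => (C j).surrogate (x j)) i

include hC hfree in
lemma measurable_othersMax (i : Fin n) : Measurable (othersMax C i) :=
  Measurable.iSup fun j => ((hC j).measurable_surrogate (hfree j)).comp (measurable_pi_apply j)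

include hC hfree in
lemma measurable_maxSurrogate : Measurable (maxSurrogate C) :=
  Measurable.iSup fun j => ((hC j).measurable_surrogate (hfree j)).comp (measurable_pi_apply j)

include hC hfree in
lemma integrable_maxSurrogate {s : ∀ i, S i} (hs : ∀ i, s i ∉ (C i).terminal) :
    Integrable (fun x => (maxSurrogate C x).toReal) (jointLaw C s) ∧
      |∫ x, (maxSurrogate C x).toReal ∂(jointLaw C s)| ≤ ∑ i, 3 * (C i).weight (s i) := by
  have he : ∀ i, MeasurePreserving (Function.eval i) (jointLaw C s)
      (pathLaw (C i).kernel (s i)) := fun i => measurePreserving_eval _ i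
  have hi : ∀ i, Integrable (fun x : ∀ i, ℕ → S i => |(C i).surr (x i)|) (jointLaw C s) :=
    fun i => (he i).integrable_comp_of_integrable ((hC i).integrable_surr (hfree i) (hs i)).abs
  have hle : ∀ x, |(maxSurrogate C x).toReal| ≤ ∑ i, |(C i).surr (x i)| :=
    fun x => abs_toReal_iSup_le _
  have hsum := integrable_finsetSum Finset.univ fun i _ => hi i
  refine ⟨hsum.mono' (measurable_maxSurrogate hC hfree).ereal_toReal.aestronglyMeasurable
    (ae_of_all _ hle), abs_integral_le_integral_abs.trans ((integral_mono_of_nonneg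
      (ae_of_all _ fun x => abs_nonneg _) hsum (ae_of_all _ hle)).trans ?_)⟩
  rw [integral_finsetSum _ fun i _ => hi i]
  refine Finset.sum_le_sum fun i _ => ?_
  refine le_trans (le_of_eq ?_) ((hC i).integral_abs_surr_le (hfree i) (hs i))
  rw [← (he i).map_eq, integral_map (measurable_pi_apply i).aemeasurable
    ((hC i).measurable_surr (hfree i)).abs.aestronglyMeasurable]

open Classical in
/-- The expected maximal surrogate value; it vanishes in terminal states. -/
def surrogateValue (C : ∀ i, RewardChain (S i)) (s : ∀ i, S i) : ℝ :=
  if ∃ i, s i ∈ (C i).terminal then 0 else ∫ x, (maxSurrogate C x).toReal ∂(jointLaw C s)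

lemma surrogateValue_of_mem {s : ∀ i, S i} (hs : ∃ i, s i ∈ (C i).terminal) :
    surrogateValue C s = 0 := by
  simp only [surrogateValue, hs, if_true]

lemma surrogateValue_of_notMem {s : ∀ i, S i} (hs : ∀ i, s i ∉ (C i).terminal) :
    surrogateValue C s = ∫ x, (maxSurrogate C x).toReal ∂(jointLaw C s) := by
  simp [surrogateValue, hs]

include hC hfree in
lemma measurable_surrogateValue : Measurable (surrogateValue C) := by
  classical
  refine Measurable.ite (selectionMDP C).measurableSet_terminal measurable_const ?_
  let κ : Kernel (∀ i, S i) (∀ i, ℕ → S i) := ⟨jointLaw C, measurable_jointLaw⟩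
  have : IsMarkovKernel κ := ⟨fun s => inferInstanceAs (IsProbabilityMeasure (jointLaw C s))⟩
  exact ((measurable_maxSurrogate hC hfree).ereal_toReal.stronglyMeasurable.integral_kernel
    (κ := κ)).measurable

include hC hfree in
lemma enorm_surrogateValue_le (s : ∀ i, S i) :
    ‖surrogateValue C s‖ₑ ≤ 0 + 3 * selectionWeight C s := by
  by_cases hs : ∃ i, s i ∈ (C i).terminal
  · simp [surrogateValue_of_mem hs]
  · push Not at hs
    have h := (integrable_maxSurrogate hC hfree hs).2
    rw [← surrogateValue_of_notMem hs, ← Finset.mul_sum] at h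
    rw [Real.enorm_eq_ofReal_abs, zero_add, selectionWeight, ← ENNReal.ofReal_sum_of_nonneg
      fun i _ => RewardChain.weight_nonneg _]
    refine (ENNReal.ofReal_le_ofReal h).trans (le_of_eq ?_)
    rw [ENNReal.ofReal_mul (by norm_num)]
    simp

include hC hfree in
lemma integrable_toReal_othersMax {s : ∀ i, S i} (i : Fin n)
    (hs : ∀ j ≠ i, s j ∉ (C j).terminal) :
    Integrable (fun y => (othersMax C i y).toReal) (othersLaw C i s) := by
  have he : ∀ j : {j // j ≠ i}, MeasurePreserving (Function.eval j) (othersLaw C i s)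
      (pathLaw (C j).kernel (s j)) := fun j => measurePreserving_eval _ j
  have hi : ∀ j : {j // j ≠ i}, Integrable (fun y : ∀ j : {j // j ≠ i}, ℕ → S j =>
      |(C j).surr (y j)|) (othersLaw C i s) :=
    fun j => (he j).integrable_comp_of_integrable
      ((hC j).integrable_surr (hfree j) (hs j j.2)).abs
  exact (integrable_finsetSum Finset.univ fun j _ => hi j).mono'
    (measurable_othersMax hC hfree i).ereal_toReal.aestronglyMeasurable
    (ae_of_all _ fun y => abs_toReal_iSup_le _)

include hC hfree in
-- Only `⊤` must be excluded; `⊥` is the genuine value of the supremum when there is a single chain.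
lemma ae_othersMax_ne_top {s : ∀ i, S i} (i : Fin n) (hs : ∀ j ≠ i, s j ∉ (C j).terminal) :
    ∀ᵐ y ∂(othersLaw C i s), othersMax C i y ≠ ⊤ := by
  have h : ∀ j : {j // j ≠ i}, ∀ᵐ y ∂(othersLaw C i s), (C j).surrogate (y j) ≠ ⊤ := by
    intro j
    have he : MeasurePreserving (Function.eval j) (othersLaw C i s)
      (pathLaw (C j).kernel (s j)) := measurePreserving_eval _ j
    filter_upwards [he.quasiMeasurePreserving.ae
      ((hC j).ae_surrogate_finite (hfree j) (hs j j.2))] with y hy using hy.2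
  filter_upwards [ae_all_iff.2 h] with y hy
  rcases isEmpty_or_nonempty {j // j ≠ i} with he | he
  · simp [othersMax]
  · obtain ⟨j, hj⟩ := exists_eq_ciSup_of_finite (f := fun j : {j // j ≠ i} =>
      (C j).surrogate (y j))
    rw [othersMax, ← hj]
    exact hy j

include hC hfree in
-- The index of each chain is the essential supremum of its surrogate value.
lemma ae_othersMax_le_iff {s : ∀ i, S i} (i : Fin n) (hs : ∀ i, s i ∉ (C i).terminal) :
    (∀ᵐ y ∂(othersLaw C i s), othersMax C i y ≤ (C i).gittins (s i)) ↔
      ∀ j, (C j).gittins (s j) ≤ (C i).gittins (s i) := by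
  have he : ∀ j : {j // j ≠ i}, MeasurePreserving (Function.eval j) (othersLaw C i s)
    (pathLaw (C j).kernel (s j)) := fun j => measurePreserving_eval _ j
  constructor
  · intro h j
    by_cases hj : j = i
    · subst hj; exact le_rfl
    · refine (hC j).le_of_ae_surrogate_le (hfree j) (hs j) ?_
      rw [← (he ⟨j, hj⟩).map_eq, ae_map_iff (he ⟨j, hj⟩).measurable.aemeasurable
        (measurableSet_le ((hC j).measurable_surrogate (hfree j)) measurable_const)]
      filter_upwards [h] with y hy
      exact (le_iSup (fun j : {j // j ≠ i} => (C j).surrogate (y j)) ⟨j, hj⟩).trans hy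
  · intro h
    have h' : ∀ j : {j // j ≠ i}, ∀ᵐ y ∂(othersLaw C i s),
        (C j).surrogate (y j) ≤ (C j).gittins (s j) := fun j =>
      (he j).quasiMeasurePreserving.ae ((hC j).ae_surrogate_le (hfree j) (hs j))
    filter_upwards [ae_all_iff.2 h'] with y hy
    exact iSup_le fun j => (hy j).trans (h j)

include hC hfree in
lemma integrable_maxValue_othersMax {s : ∀ i, S i} (i : Fin n)
    (hs : ∀ j ≠ i, s j ∉ (C j).terminal) (s' : S i) :
    Integrable (fun y => (C i).maxValue (othersMax C i y) s') (othersLaw C i s) := by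
  refine ((integrable_toReal_othersMax hC hfree i hs).abs.add (integrable_const
    (3 * (C i).weight s'))).mono' ?_ (ae_of_all _ fun y => (hC i).abs_maxValue_le (hfree i) _ s')
  exact (((hC i).measurable_maxValue (hfree i)).comp
    ((measurable_othersMax hC hfree i).prodMk measurable_const)).aestronglyMeasurable

include hC hfree in
lemma integrable_maxValue_prod {s : ∀ i, S i} (i : Fin n)
    (hs : ∀ j ≠ i, s j ∉ (C j).terminal) (s₀ : S i) :
    Integrable (Function.uncurry fun s' y => (C i).maxValue (othersMax C i y) s')
      (((C i).kernel s₀).prod (othersLaw C i s)) := by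
  refine (((integrable_toReal_othersMax hC hfree i hs).abs.comp_snd ((C i).kernel s₀)).add
    ((((hC i).integrable_weight s₀).const_mul 3).comp_fst (othersLaw C i s))).mono' ?_
    (ae_of_all _ fun p => (hC i).abs_maxValue_le (hfree i) _ p.1)
  exact (((hC i).measurable_maxValue (hfree i)).comp
    (((measurable_othersMax hC hfree i).comp measurable_snd).prodMk
      measurable_fst)).aestronglyMeasurable

include hC hfree in
-- Conditioning on the other chains. Their law does not see coordinate `i`, so one measure serves
-- all `s'`, including terminal ones, where both sides vanish.
lemma surrogateValue_update {s : ∀ i, S i} (i : Fin n)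
    (hs : ∀ j ≠ i, s j ∉ (C j).terminal) (s' : S i) :
    surrogateValue C (Function.update s i s') =
      ∫ y, (C i).maxValue (othersMax C i y) s' ∂(othersLaw C i s) := by
  by_cases h : s' ∈ (C i).terminal
  · rw [surrogateValue_of_mem ⟨i, by simpa using h⟩]
    simp [RewardChain.maxValue_of_mem _ h]
  · have hs' : ∀ j, Function.update s i s' j ∉ (C j).terminal := by
      intro j
      by_cases hj : j = i
      · subst hj; simpa using h
      · rw [Function.update_of_ne hj]; exact hs j hj
    have hint := (integrable_maxSurrogate hC hfree hs').1
    have hsplit := measurePreserving_split (C := C) i (Function.update s i s')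
    rw [othersLaw_update, Function.update_self] at hsplit
    have hm : Measurable fun p : (∀ j : {j // j ≠ i}, ℕ → S j) × (ℕ → S i) =>
        (max (othersMax C i p.1) ((C i).surrogate p.2)).toReal :=
      (((measurable_othersMax hC hfree i).comp measurable_fst).max
        (((hC i).measurable_surrogate (hfree i)).comp measurable_snd)).ereal_toReal
    have heq : ∀ x, (maxSurrogate C x).toReal =
        (fun p : (∀ j : {j // j ≠ i}, ℕ → S j) × (ℕ → S i) =>
          (max (othersMax C i p.1) ((C i).surrogate p.2)).toReal)
          ((fun j : {j // j ≠ i} => x j), x i) := fun x => by rw [maxSurrogate_eq_max i]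
    rw [surrogateValue_of_notMem hs']
    simp only [heq] at hint ⊢
    have hint' := (hsplit.integrable_comp hm.aestronglyMeasurable).1 hint
    have h1 := integral_map (μ := jointLaw C (Function.update s i s'))
      hsplit.measurable.aemeasurable hm.aestronglyMeasurable
    rw [hsplit.map_eq] at h1
    rw [← h1, integral_prod _ hint']
    simp only [RewardChain.maxValue_of_notMem _ h]

include hC hfree in
lemma integrable_surrogateValue_update {s : ∀ i, S i} (i : Fin n)
    (hs : ∀ j ≠ i, s j ∉ (C j).terminal) :
    Integrable (fun s' => surrogateValue C (Function.update s i s')) ((C i).kernel (s i)) := by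
  simp only [surrogateValue_update hC hfree i hs]
  exact (integrable_maxValue_prod hC hfree i hs (s i)).integral_prod_left

include hC hfree in
/-- The loss of the `i`-th action as an integral of the losses against fixed alternatives. -/
lemma surrogateValue_sub_bellman {s : ∀ i, S i} (i : Fin n) (hs : ∀ i, s i ∉ (C i).terminal) :
    Integrable (fun y => (C i).maxValue (othersMax C i y) (s i) - ((C i).reward (s i) +
      ∫ s', (C i).maxValue (othersMax C i y) s' ∂((C i).kernel (s i)))) (othersLaw C i s) ∧
    surrogateValue C s - bellman C i (surrogateValue C) s =
      ∫ y, ((C i).maxValue (othersMax C i y) (s i) - ((C i).reward (s i) +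
        ∫ s', (C i).maxValue (othersMax C i y) s' ∂((C i).kernel (s i)))) ∂(othersLaw C i s) := by
  have hs' : ∀ j ≠ i, s j ∉ (C j).terminal := fun j _ => hs j
  have hprod := integrable_maxValue_prod hC hfree i hs' (s i)
  have h1 := integrable_maxValue_othersMax hC hfree i hs' (s i)
  have h3 : Integrable (fun y => ∫ s', (C i).maxValue (othersMax C i y) s' ∂((C i).kernel (s i)))
      (othersLaw C i s) := hprod.integral_prod_right
  have h2 : Integrable (fun y => (C i).reward (s i) +
      ∫ s', (C i).maxValue (othersMax C i y) s' ∂((C i).kernel (s i))) (othersLaw C i s) :=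
    (integrable_const _).add h3
  refine ⟨h1.sub h2, ?_⟩
  rw [integral_sub h1 h2, integral_add (integrable_const _) h3]
  have h4 := surrogateValue_update hC hfree i hs' (s i)
  rw [Function.update_eq_self] at h4
  rw [h4, bellman]
  simp only [surrogateValue_update hC hfree i hs']
  -- Fubini exchanges the transition of chain `i` with the draw of the others' maximum.
  rw [integral_integral_swap hprod]
  simp

include hC hfree in
lemma ae_loss_nonneg {s : ∀ i, S i} (i : Fin n) (hs : ∀ i, s i ∉ (C i).terminal) :
    0 ≤ᵐ[othersLaw C i s] fun y => (C i).maxValue (othersMax C i y) (s i) - ((C i).reward (s i) +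
      ∫ s', (C i).maxValue (othersMax C i y) s' ∂((C i).kernel (s i))) := by
  filter_upwards [ae_othersMax_ne_top hC hfree i fun j _ => hs j] with y hy
  exact sub_nonneg.2 ((hC i).step_maxValue_le (hfree i) hy (hs i))

include hC hfree in
theorem bellman_surrogateValue_le {s : ∀ i, S i} (i : Fin n) (hs : ∀ i, s i ∉ (C i).terminal) :
    bellman C i (surrogateValue C) s ≤ surrogateValue C s := by
  rw [← sub_nonneg, (surrogateValue_sub_bellman hC hfree i hs).2]
  exact integral_nonneg_of_ae (ae_loss_nonneg hC hfree i hs)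

include hC hfree in
-- A nonnegative loss integrates to zero iff it vanishes almost surely, that is, iff the others'
-- maximum almost surely stays below the index of chain `i`.
theorem bellman_surrogateValue_eq_iff {s : ∀ i, S i} (i : Fin n)
    (hs : ∀ i, s i ∉ (C i).terminal) :
    bellman C i (surrogateValue C) s = surrogateValue C s ↔
      ∀ j, (C j).gittins (s j) ≤ (C i).gittins (s i) := by
  obtain ⟨hint, heq⟩ := surrogateValue_sub_bellman hC hfree i hs
  rw [eq_comm, ← sub_eq_zero, heq,
    integral_eq_zero_iff_of_nonneg_ae (ae_loss_nonneg hC hfree i hs) hint,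
    ← ae_othersMax_le_iff hC hfree i hs]
  have htop := ae_othersMax_ne_top hC hfree i fun j _ => hs j
  constructor
  · intro h
    filter_upwards [h, htop] with y hy hy'
    exact ((hC i).step_maxValue_eq_iff (hfree i) hy' (hs i)).1 (sub_eq_zero.1 hy).symm
  · intro h
    filter_upwards [h, htop] with y hy hy'
    exact sub_eq_zero.2 (((hC i).step_maxValue_eq_iff (hfree i) hy' (hs i)).2 hy).symm

include hC hfree in
lemma integrable_surrogateValue_policyKernel (π : Policy (∀ i, S i) (Fin n)) {s : ∀ i, S i}
    (hs : s ∉ (selectionMDP C).terminal) :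
    Integrable (surrogateValue C) ((selectionMDP C).policyKernel π s) ∧
      (selectionMDP C).policyReward π s +
        ∫ z, surrogateValue C z ∂((selectionMDP C).policyKernel π s) =
        bellman C (π.1 s) (surrogateValue C) s := by
  have hm := measurable_surrogateValue hC hfree
  rw [selectionMDP_policyKernel_apply, integrable_map_measure hm.aestronglyMeasurable
    (measurable_update _).aemeasurable, integral_map (measurable_update _).aemeasurable
    hm.aestronglyMeasurable]
  exact ⟨integrable_surrogateValue_update hC hfree _ fun j _ => notMem_terminal hs j, rfl⟩

include hC hfree in
theorem value_le_surrogateValue (hn : 0 < n) (π : Policy (∀ i, S i) (Fin n)) (s : ∀ i, S i) :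
    (selectionMDP C).value π s ≤ surrogateValue C s := by
  refine totalValue_le (selectionMDP C).measurableSet_terminal
    (RewardChain.measurable_policyReward _ π) (selection_terminates hC hn π)
    (smallTails_selection hC π) zero_ne_top (b := 3) (by finiteness) (fun s => ?_)
    (enorm_surrogateValue_le hC hfree) (fun s hs => surrogateValue_of_mem hs)
    (fun s hs => ?_) s
  · refine (absValue_selection_le hC π s).trans ?_
    rw [zero_add]
    exact le_mul_of_one_le_left bot_le (by norm_num)
  · obtain ⟨h1, h2⟩ := integrable_surrogateValue_policyKernel hC hfree π hs
    exact ⟨h1, h2.le.trans (bellman_surrogateValue_le hC hfree _ (notMem_terminal hs))⟩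

include hC hfree in
theorem value_eq_surrogateValue (hn : 0 < n) {π : Policy (∀ i, S i) (Fin n)}
    (hπ : IsGittinsPolicy C π) (s : ∀ i, S i) :
    (selectionMDP C).value π s = surrogateValue C s := by
  refine le_antisymm (value_le_surrogateValue hC hfree hn π s) ?_
  refine le_totalValue (selectionMDP C).measurableSet_terminal
    (RewardChain.measurable_policyReward _ π) (selection_terminates hC hn π)
    (smallTails_selection hC π) zero_ne_top (b := 3) (by finiteness) (fun s => ?_)
    (enorm_surrogateValue_le hC hfree) (fun s hs => surrogateValue_of_mem hs)
    (fun s hs => ?_) s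
  · refine (absValue_selection_le hC π s).trans ?_
    rw [zero_add]
    exact le_mul_of_one_le_left bot_le (by norm_num)
  · obtain ⟨h1, h2⟩ := integrable_surrogateValue_policyKernel hC hfree π hs
    refine ⟨h1, ?_⟩
    rw [h2, (bellman_surrogateValue_eq_iff hC hfree _ (notMem_terminal hs)).2 (hπ s hs)]

include hC hfree in
theorem exists_isGittinsPolicy (hn : 0 < n) :
    ∃ π : Policy (∀ i, S i) (Fin n), IsGittinsPolicy C π := by
  classical
  have hne : Nonempty (Fin n) := ⟨⟨0, hn⟩⟩
  -- Breaking ties by the least chain number keeps the selection measurable.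
  let p : (∀ i, S i) → ℕ → Prop := fun s k =>
    ∃ h : k < n, ∀ j, (C j).gittins (s j) ≤ (C ⟨k, h⟩).gittins (s ⟨k, h⟩)
  have hp : ∀ s, ∃ k, p s k := by
    intro s
    obtain ⟨i, hi⟩ := Finite.exists_max fun j => (C j).gittins (s j)
    exact ⟨i, i.2, hi⟩
  have hg : ∀ j, Measurable fun s : ∀ i, S i => (C j).gittins (s j) := fun j =>
    ((hC j).measurable_gittins (hfree j)).comp (measurable_pi_apply j)
  have hm : ∀ k, MeasurableSet {s | p s k} := by
    intro k
    by_cases hk : k < n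
    · have : {s | p s k} = ⋂ j, {s : ∀ i, S i |
          (C j).gittins (s j) ≤ (C ⟨k, hk⟩).gittins (s ⟨k, hk⟩)} := by
        ext s; simp [p, hk]
      rw [this]
      exact MeasurableSet.iInter fun j => measurableSet_le (hg j) (hg _)
    · have : {s | p s k} = ∅ := by ext s; simp [p, hk]
      rw [this]
      exact MeasurableSet.empty
  have hfind := measurable_find hp hm
  refine ⟨⟨fun s => ⟨Nat.find (hp s), (Nat.find_spec (hp s)).1⟩, ?_⟩, fun s _ =>
    (Nat.find_spec (hp s)).2⟩
  refine measurable_to_countable' fun i => ?_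
  have : (fun s => (⟨Nat.find (hp s), (Nat.find_spec (hp s)).1⟩ : Fin n)) ⁻¹' {i} =
      (fun s => Nat.find (hp s)) ⁻¹' {(i : ℕ)} := by
    ext s; simp [Fin.ext_iff]
  rw [this]
  exact hfind (measurableSet_singleton _)

include hC hfree in
theorem optimalValue_eq_surrogateValue (hn : 0 < n) (s : ∀ i, S i) :
    (selectionMDP C).optimalValue s = surrogateValue C s := by
  obtain ⟨π, hπ⟩ := exists_isGittinsPolicy hC hfree hn
  have : Nonempty (Policy (∀ i, S i) (Fin n)) := ⟨π⟩
  refine le_antisymm (ciSup_le fun π => value_le_surrogateValue hC hfree hn π s) ?_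
  rw [← value_eq_surrogateValue hC hfree hn hπ s]
  exact le_ciSup (f := fun π => (selectionMDP C).value π s) ⟨surrogateValue C s, by
    rintro _ ⟨π, rfl⟩; exact value_le_surrogateValue hC hfree hn π s⟩ π

end SelectionValue

end MCS

end

theorem mainTheorem2 {n : ℕ} (hn : 0 < n) {S : Fin n → Type*} [∀ i, MeasurableSpace (S i)]
    (C : ∀ i, MCS.RewardChain (S i))
    (hterm : ∀ i s, MCS.TerminatesIntegrably (C i).kernel (C i).terminal (C i).reward s)
    (hfree : ∀ i s, ¬ (C i).IsFree s) :
    -- every policy terminates almost surely with absolutely integrable total reward,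
    -- and the optimal value is an upper bound for its value
    (∀ (π : MCS.Policy (∀ i, S i) (Fin n)) (s : ∀ i, S i),
      MCS.TerminatesIntegrably ((MCS.selectionMDP C).policyKernel π) (MCS.selectionMDP C).terminal
          ((MCS.selectionMDP C).policyReward π) s ∧
        (MCS.selectionMDP C).value π s ≤ (MCS.selectionMDP C).optimalValue s) ∧
    -- surrogate values of non-terminal states are almost surely finite
    (∀ (i : Fin n) (s : S i), s ∉ (C i).terminal →
      ∀ᵐ x ∂(MCS.pathLaw (C i).kernel s),
        (C i).surrogate x ≠ ⊥ ∧ (C i).surrogate x ≠ ⊤) ∧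
    -- the formula for the optimal value function
    (∀ s : ∀ i, S i, (∀ i, s i ∉ (C i).terminal) →
      Integrable (fun x => (MCS.maxSurrogate C x).toReal) (MCS.jointLaw C s) ∧
        (MCS.selectionMDP C).optimalValue s =
          ∫ x, (MCS.maxSurrogate C x).toReal ∂(MCS.jointLaw C s)) ∧
    (∀ s : ∀ i, S i, (∃ i, s i ∈ (C i).terminal) → (MCS.selectionMDP C).optimalValue s = 0) ∧
    -- the Bellman equation and its maximizers
    (∀ s : ∀ i, S i, (∀ i, s i ∉ (C i).terminal) →
      (∀ i, Integrable (fun s' => (MCS.selectionMDP C).optimalValue (Function.update s i s'))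
        ((C i).kernel (s i))) ∧
      (MCS.selectionMDP C).optimalValue s =
        ⨆ i, MCS.bellman C i (MCS.selectionMDP C).optimalValue s ∧
      {i | ∀ j, MCS.bellman C j (MCS.selectionMDP C).optimalValue s ≤
          MCS.bellman C i (MCS.selectionMDP C).optimalValue s} =
        {i | ∀ j, (C j).gittins (s j) ≤ (C i).gittins (s i)}) ∧
    -- a Gittins policy exists, and every Gittins policy attains the optimal value
    (∃ π : MCS.Policy (∀ i, S i) (Fin n), MCS.IsGittinsPolicy C π) ∧
    (∀ π : MCS.Policy (∀ i, S i) (Fin n), MCS.IsGittinsPolicy C π →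
      ∀ s, (MCS.selectionMDP C).value π s = (MCS.selectionMDP C).optimalValue s) := by
  have hC : ∀ i, (C i).Terminating := hterm
  have hopt := MCS.optimalValue_eq_surrogateValue hC hfree hn
  have hoptfun : (MCS.selectionMDP C).optimalValue = MCS.surrogateValue C := funext hopt
  refine ⟨fun π s => ⟨MCS.selection_terminates hC hn π s, ?_⟩, fun i s hs =>
    (hC i).ae_surrogate_finite (hfree i) hs, fun s hs => ?_, fun s hs => ?_, fun s hs => ?_,
    MCS.exists_isGittinsPolicy hC hfree hn, fun π hπ s => ?_⟩
  · rw [hopt]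
    exact MCS.value_le_surrogateValue hC hfree hn π s
  · rw [hopt]
    exact ⟨(MCS.integrable_maxSurrogate hC hfree hs).1, MCS.surrogateValue_of_notMem hs⟩
  · rw [hopt]
    exact MCS.surrogateValue_of_mem hs
  · rw [hoptfun]
    have hne : Nonempty (Fin n) := ⟨⟨0, hn⟩⟩
    have hle := fun i => MCS.bellman_surrogateValue_le hC hfree i hs
    have hiff := fun i => MCS.bellman_surrogateValue_eq_iff hC hfree i hs
    obtain ⟨k, hk⟩ := Finite.exists_max fun j => (C j).gittins (s j)
    have hk' := (hiff k).2 hk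
    refine ⟨fun i => MCS.integrable_surrogateValue_update hC hfree i fun j _ => hs j,
      le_antisymm ?_ (ciSup_le hle), ?_⟩
    · rw [← hk']
      exact le_ciSup (f := fun i => MCS.bellman C i (MCS.surrogateValue C) s)
        (Set.finite_range _).bddAbove k
    · ext i
      constructor
      · intro h
        exact (hiff i).1 (le_antisymm (hle i) (hk'.symm.le.trans (h k)))
      · intro h j
        exact (hle j).trans ((hiff i).2 h).symm.le
  · rw [hopt]
    exact MCS.value_eq_surrogateValue hC hfree hn hπ s
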